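/- Let $K$ be a field and let $X_\Sigma$ be a projective toric variety over $K$ with split dense torus, given by a simplicial fan $\Sigma$ in $N_{\mathbb R}\simeq\mathbb R^n$. For each ray $\rho\in\Sigma(1)$ let $D_\rho$ be the corresponding torus-invariant prime divisor, and for a 1-cycle $C$ on $X_\Sigma$ put $J_C^+=\{\rho\in\Sigma(1) : C\cdot D_\rho>0\}$. Denote by $[C]$ the numerical class of $C$ and by $\overline{\mathrm{NE}}(X_\Sigma)$ the Mori cone, i.e. the closure of the convex cone generated by the numerical classes of effective 1-cycles; a class is called extremal if it is nonzero and generates an extremal ray of $\overline{\mathrm{NE}}(X_\Sigma)$. Let $D$ be an ample divisor on $X_\Sigma$. Then the following conditions are equivalent: (1) there exist an effective 1-cycle $C$ on $X_\Sigma$ and a subset $I\subseteq\Sigma(1)$ such that $$C\cdot D<\sum_{\rho\in I}C\cdot D_\rho ;$$ (2) there exists a 1-cycle $C$ on $X_\Sigma$ whose class $[C]$ is extremal and such that $$C\cdot D<\sum_{\rho\in J_C^+}C\cdot D_\rho .$$ -/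

import Mathlib

/-!
Simplicial toric varieties over a field `K` with split torus, their curves and intersection numbers.

The lattices `N` and `M` are both `ℤⁿ`, paired by the dot product.
-/

open scoped Topology WithZero NNReal

noncomputable section

namespace Toric

/-- The real cone spanned by the vectors `u ρ`, `ρ ∈ S`, in `N_ℝ = ℝⁿ`. -/
def coneOf {n : ℕ} {ι : Type*} [Fintype ι] (u : ι → Fin n → ℤ) (S : Set ι) : Set (Fin n → ℝ) :=
  {x | ∃ c : ι → ℝ, (∀ ρ, 0 ≤ c ρ) ∧ (∀ ρ, ρ ∉ S → c ρ = 0) ∧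
    ∀ i, x i = ∑ ρ, c ρ * (u ρ i : ℝ)}

/-- A simplicial fan in `N_ℝ = ℝⁿ`. The type `ι` is the set `Σ(1)` of one-dimensional cones, `u ρ`
is the minimal generator of `ρ`, and a cone `σ` of the fan is recorded by the set `σ(1)` of its
rays, so that the dimension of `σ` is the cardinality of `σ(1)` and the faces of `σ` are the cones
over the subsets of `σ(1)`. -/
structure SimplicialFan (n : ℕ) (ι : Type*) [Fintype ι] where
  /-- the minimal generators of the rays -/
  u : ι → Fin n → ℤ
  /-- the cones, each given by its set of rays -/
  cones : Set (Finset ι)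
  /-- each `u ρ` is a primitive vector of the lattice -/
  primitive : ∀ (ρ : ι) (k : ℤ) (w : Fin n → ℤ), u ρ = k • w → IsUnit k
  /-- the zero cone belongs to the fan -/
  empty_mem : ∅ ∈ cones
  /-- every ray is a cone of the fan -/
  singleton_mem : ∀ ρ, {ρ} ∈ cones
  /-- faces of cones of the fan belong to the fan -/
  face_mem : ∀ σ ∈ cones, ∀ τ ⊆ σ, τ ∈ cones
  /-- the generators of a cone are linearly independent (the cones are simplicial) -/
  linearIndependent : ∀ σ ∈ cones,
    LinearIndependent ℝ (fun (ρ : {ρ // ρ ∈ σ}) (i : Fin n) => (u ρ i : ℝ))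
  /-- two cones of the fan meet along a common face -/
  inter_subset : ∀ σ ∈ cones, ∀ τ ∈ cones,
    coneOf u (σ : Set ι) ∩ coneOf u (τ : Set ι) ⊆ coneOf u ((σ : Set ι) ∩ (τ : Set ι))

section Places

variable (K F : Type*) [Field K] [Field F] [Algebra K F]

/-- A place of `F / K`: a normalised discrete valuation of `F`, trivial on `K`. When `F / K` is the
function field of a complete curve, these are the closed points of the normalisation of the
curve. -/
structure Place where
  /-- the valuation, in multiplicative notation -/
  val : Valuation F ℤᵐ⁰
  surjective : Function.Surjective val
  trivial : ∀ c : K, c ≠ 0 → val (algebraMap K F c) = 1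

variable {K F}

/-- The order of vanishing of a nonzero `f` at a place. -/
def Place.ord (v : Place K F) (f : F) : ℤ := -WithZero.log (v.val f)

theorem Place.algebraMap_mem (v : Place K F) (c : K) :
    algebraMap K F c ∈ v.val.valuationSubring := by
  rw [Valuation.mem_valuationSubring_iff]
  by_cases hc : c = 0
  · simp [hc]
  · exact (v.trivial c hc).le

/-- The map from `K` to the residue field of a place. -/
def Place.toResidueField (v : Place K F) :
    K →+* IsLocalRing.ResidueField v.val.valuationSubring :=
  (IsLocalRing.residue v.val.valuationSubring).comp
    ((algebraMap K F).codRestrict v.val.valuationSubring v.algebraMap_mem)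

/-- The degree over `K` of the residue field of a place. -/
def Place.deg (v : Place K F) : ℕ :=
  letI := v.toResidueField.toAlgebra
  Module.finrank K (IsLocalRing.ResidueField v.val.valuationSubring)

end Places

namespace SimplicialFan

variable {n : ℕ} {ι : Type*} [Fintype ι] (X : SimplicialFan n ι)

/-- The closed real cone of `N_ℝ` with set of rays `σ`. -/
def cone (σ : Finset ι) : Set (Fin n → ℝ) := coneOf X.u (σ : Set ι)

/-- The set `Σ(n)` of full-dimensional cones. -/
def maxCones : Set (Finset ι) := {σ | σ ∈ X.cones ∧ σ.card = n}

/-- The cones of the fan cover `N_ℝ`. -/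
def IsComplete : Prop := ∀ x : Fin n → ℝ, ∃ σ ∈ X.cones, x ∈ X.cone σ

/-- `D = ∑ a_ρ D_ρ` is ample: some positive multiple `k D` is an ample Cartier divisor. That is, for
each `σ ∈ Σ(n)` there is a character `m ∈ M` (the Cartier datum of `k D` at `σ`) with
`⟨m, u_ρ⟩ ≥ - k a_ρ` for all `ρ`, with equality exactly for the `ρ ∈ σ(1)`. In other words `χ^m` is
a global section of `𝒪(k D)` whose nonvanishing locus is the affine chart `U_σ`. -/
def IsAmple (D : ι → ℤ) : Prop :=
  ∃ k : ℕ, 0 < k ∧ ∀ σ ∈ X.maxCones, ∃ m : Fin n → ℤ,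
    (∀ ρ ∈ σ, m ⬝ᵥ X.u ρ = -(k * D ρ)) ∧ (∀ ρ, ρ ∉ σ → -(k * D ρ) < m ⬝ᵥ X.u ρ)

/-- The toric variety of the fan is projective: it is complete and carries an ample divisor. -/
def IsProjective : Prop := X.IsComplete ∧ ∃ A : ι → ℤ, X.IsAmple A

/-- The sublattice `γ^⊥ ∩ M`. -/
def perp (γ : Finset ι) : AddSubgroup (Fin n → ℤ) where
  carrier := {m | ∀ ρ ∈ γ, m ⬝ᵥ X.u ρ = 0}
  zero_mem' := fun ρ _ => zero_dotProduct (X.u ρ)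
  add_mem' := fun {a b} ha hb ρ hρ => by rw [add_dotProduct, ha ρ hρ, hb ρ hρ, add_zero]
  neg_mem' := fun {a} ha ρ hρ => by rw [neg_dotProduct, ha ρ hρ, neg_zero]

/-- The coordinate ring `K[γ^⊥ ∩ M]` of the torus orbit `O(γ)`. -/
abbrev OrbitRing (K : Type*) [Field K] (γ : Finset ι) : Type _ := AddMonoidAlgebra K (X.perp γ)

/-- An irreducible curve (one-dimensional integral closed subscheme) on the toric variety over `K`.
The variety is the disjoint union of the torus orbits `O(γ) = Spec K[γ^⊥ ∩ M]`, `γ` in the fan, and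
an irreducible curve is the closure of its generic point; so it is given by the orbit `O(γ)`
that contains this point and by a prime ideal of `K[γ^⊥ ∩ M]` whose residue field, the function
field of the curve, has transcendence degree one over `K`. -/
structure Curve (K : Type*) [Field K] where
  /-- the cone of the orbit that contains the generic point -/
  orbit : Finset ι
  orbit_mem : orbit ∈ X.cones
  /-- the ideal of the curve in its orbit -/
  ideal : Ideal (X.OrbitRing K orbit)
  isPrime : ideal.IsPrime
  trdeg_eq_one : Algebra.trdeg K ideal.ResidueField = 1

/-- The Cartier datum `m_σ(D) ∈ M_ℚ` of a (`ℚ`-Cartier) divisor `D = ∑ a_ρ D_ρ` at `σ ∈ Σ(n)`: the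
unique solution of `⟨m, u_ρ⟩ = - a_ρ`, `ρ ∈ σ(1)`. On the chart `U_σ`, the divisor `D` is the
divisor of `χ^{-m_σ(D)}`. -/
def cartierDatum (D : ι → ℤ) (σ : Finset ι) : Fin n → ℚ :=
  Classical.epsilon fun m => ∀ ρ ∈ σ, (m ⬝ᵥ fun i => (X.u ρ i : ℚ)) = -(D ρ : ℚ)

namespace Curve

variable {X} {K : Type*} [Field K] (C : X.Curve K)

instance : C.ideal.IsPrime := C.isPrime

/-- The function field of the curve. -/
abbrev FunctionField : Type _ := C.ideal.ResidueField

/-- The restriction to the curve of a character `χ^m`, `m ∈ γ^⊥ ∩ M`. -/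
def char (m : X.perp C.orbit) : C.FunctionField :=
  algebraMap (X.OrbitRing K C.orbit) C.FunctionField (AddMonoidAlgebra.single m 1)

/-- A full-dimensional cone `σ₀` that has `γ` as a face, that is, such that the chart `U_{σ₀}`
contains the generic point of the curve. -/
def chart : Finset ι := Classical.epsilon fun σ => σ ∈ X.maxCones ∧ C.orbit ⊆ σ

/-- `(σ, w)` locates the place `v`. The vector `w ∈ N` represents the homomorphism
`γ^⊥ ∩ M → ℤ`, `m ↦ ord_v (χ^m)`, which is an element of `N(γ) = N / N_γ`. That `w` lies in a cone
`σ ∈ Σ(n)` with face `γ` says that the functions on the chart `U_σ` are regular at `v`, that is, the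
point `v` of the normalisation of the curve maps into `U_σ`. -/
def IsLocation (v : Place K C.FunctionField) (p : Finset ι × (Fin n → ℤ)) : Prop :=
  p.1 ∈ X.maxCones ∧ C.orbit ⊆ p.1 ∧
    (∀ m : X.perp C.orbit, v.ord (C.char m) = (m : Fin n → ℤ) ⬝ᵥ p.2) ∧
    (fun i => (p.2 i : ℝ)) ∈ X.cone p.1

/-- A choice of `(σ, w)` as above (one exists if the fan is complete). -/
def location (v : Place K C.FunctionField) : Finset ι × (Fin n → ℤ) :=
  Classical.epsilon (C.IsLocation v)

/-- The order at the place `v` of the local equation of the divisor `D + div (χ^{m_{σ₀}(D)})`, where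
`σ₀` is the chart chosen above. This divisor is `ℚ`-linearly equivalent to `D` and trivial on
`U_{σ₀}`, so it does not contain the curve. If `v` maps into `U_σ`, its local equation at `v` is
`χ^{m_{σ₀}(D) - m_σ(D)}`, where `m_{σ₀}(D) - m_σ(D)` lies in `γ^⊥ ⊆ M_ℚ`. -/
def localOrd (D : ι → ℤ) (v : Place K C.FunctionField) : ℚ :=
  (X.cartierDatum D C.chart - X.cartierDatum D (C.location v).1) ⬝ᵥ
    fun i => ((C.location v).2 i : ℚ)

/-- The intersection number `C · D`: the degree of the pullback of `D` to the normalisation of the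
curve (only finitely many terms of the sum are nonzero). -/
def inter (D : ι → ℤ) : ℚ :=
  ∑ᶠ v : Place K C.FunctionField, (v.deg : ℚ) * C.localOrd D v

end Curve

variable (K : Type*) [Field K]

/-- The group of 1-cycles. -/
abbrev OneCycle : Type _ := X.Curve K →₀ ℤ

variable {X K}

/-- The intersection number `C · D` of a 1-cycle `C` with `D = ∑ a_ρ D_ρ`. -/
def OneCycle.inter (C : X.OneCycle K) (D : ι → ℤ) : ℚ :=
  C.sum fun Z k => (k : ℚ) * Z.inter D

/-- All coefficients of the 1-cycle are nonnegative. -/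
def OneCycle.IsEffective (C : X.OneCycle K) : Prop := ∀ Z, 0 ≤ C Z

open scoped Classical in
/-- The prime divisor `D_ρ`. -/
def rayDivisor (ρ : ι) : ι → ℤ := Pi.single ρ 1

/-- The numerical class `[C]`, in the space `N_1` realised (as usual) inside `ℝ^{Σ(1)}` by
`[C] ↦ (C · D_ρ)_ρ`. The classes of the `D_ρ` generate the class group, so two 1-cycles have the
same class if and only if they are numerically equivalent. -/
def OneCycle.numClass (C : X.OneCycle K) : ι → ℝ := fun ρ => (C.inter (rayDivisor ρ) : ℝ)

/-- The set `J_C^+` of the rays `ρ` with `C · D_ρ > 0`. -/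
def OneCycle.Jplus (C : X.OneCycle K) : Finset ι :=
  Finset.univ.filter fun ρ => 0 < C.inter (rayDivisor ρ)

variable (X K)

/-- The Mori cone: the closure of the convex cone generated by the numerical classes of effective
1-cycles. -/
def moriCone : Set (ι → ℝ) :=
  closure (Submodule.span ℝ≥0
    {c : ι → ℝ | ∃ C : X.OneCycle K, C.IsEffective ∧ c = C.numClass} : Set (ι → ℝ))

/-- `c` is an extremal class: it is a nonzero element of the Mori cone, and the ray `ℝ₊ c` that it
generates is an extremal ray of the Mori cone. -/
def IsExtremalClass (c : ι → ℝ) : Prop :=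
  c ∈ X.moriCone K ∧ c ≠ 0 ∧
    ∀ x ∈ X.moriCone K, ∀ y ∈ X.moriCone K, (∃ t : ℝ≥0, x + y = t • c) →
      (∃ s : ℝ≥0, x = s • c) ∧ (∃ s : ℝ≥0, y = s • c)

end SimplicialFan

end Toric

end

/-! For a fixed set `I` the difference `∑_{ρ ∈ I} C·D_ρ - C·D` is a linear form in the class of `C`
(`excessForm`), and replacing `I` by `J_C^+` can only increase it. Given (1), the class of `C` is a
nonnegative combination of a minimal finite set of generators of the Mori cone. The form is positive
on one of them, which is the class of a curve and spans an extremal ray. Given (2), positivity of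
the form is an open condition, so it holds somewhere in the cone before taking the closure, and
therefore for some effective cycle, with the same set of rays.

The substance is the toric cone theorem `exists_moriCone_eq_span`. Classes are treated as linear
relations among the ray generators, and `rel σ ρ` is the relation expressing `u_ρ` through the
generators of `σ`. By `Curve.localOrd_rayDivisor`, a place of a curve contributes relations `rel σ₀
ρ`, weighted by the coordinates of a vector in the cone where the place is located; these weights
are nonnegative. By `rel_mem_span`, each such relation is a nonnegative combination of wall
relations: crossing a wall towards `u_ρ` splits one off, and ampleness makes the degree of the
remainder drop. By `IsWall.exists_curve`, a wall relation is a positive multiple of the class of the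
closure of a one-dimensional orbit.

There are finitely many walls and `D` is positive on their relations. Hence the cone they generate
is already closed (`isClosed_span_of_pos`), and its minimal generators are extremal
(`extremal_of_notMem_span`). -/

noncomputable section

namespace Toric

/-! ### Places of a function field: finiteness of zeros and poles -/

namespace Place

variable {K F : Type*} [Field K] [Field F] [Algebra K F]

theorem val_algebraMap_le_one (v : Place K F) (c : K) : v.val (algebraMap K F c) ≤ 1 := by
  by_cases hc : c = 0
  · simp [hc]
  · exact (v.trivial c hc).le

theorem val_eq_exp (v : Place K F) {f : F} (hf : f ≠ 0) : v.val f = WithZero.exp (-v.ord f) := by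
  rw [ord, neg_neg, WithZero.exp_log ((Valuation.ne_zero_iff _).2 hf)]

theorem ord_mul (v : Place K F) {f g : F} (hf : f ≠ 0) (hg : g ≠ 0) :
    v.ord (f * g) = v.ord f + v.ord g := by
  rw [ord, map_mul, WithZero.log_mul ((Valuation.ne_zero_iff _).2 hf)
    ((Valuation.ne_zero_iff _).2 hg), ord, ord, neg_add]

@[simp] theorem ord_one (v : Place K F) : v.ord (1 : F) = 0 := by simp [ord]

theorem ord_inv (v : Place K F) {f : F} (hf : f ≠ 0) : v.ord f⁻¹ = -v.ord f := by
  have h := v.ord_mul hf (inv_ne_zero hf)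
  rw [mul_inv_cancel₀ hf, ord_one] at h
  omega

theorem val_lt_one_iff (v : Place K F) {f : F} (hf : f ≠ 0) : v.val f < 1 ↔ 0 < v.ord f := by
  rw [v.val_eq_exp hf, ← WithZero.exp_zero, WithZero.exp_lt_exp]
  omega

theorem ext_val {v w : Place K F} (h : v.val = w.val) : v = w := by
  cases v; cases w; cases h; rfl

/-- Two places with the same valuation ring are equal. -/
theorem eq_of_forall_val_le_one {v w : Place K F} (h : ∀ x, v.val x ≤ 1 ↔ w.val x ≤ 1) :
    v = w := by
  have hord : ∀ x : F, x ≠ 0 → (0 ≤ v.ord x ↔ 0 ≤ w.ord x) := by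
    intro x hx
    have := h x
    rw [v.val_eq_exp hx, w.val_eq_exp hx, ← WithZero.exp_zero, WithZero.exp_le_exp,
      WithZero.exp_le_exp] at this
    omega
  have hzero : ∀ x : F, x ≠ 0 → v.ord x = 0 → w.ord x = 0 := by
    intro x hx h0
    have h1 := hord x hx
    have h2 := hord x⁻¹ (inv_ne_zero hx)
    rw [v.ord_inv hx, w.ord_inv hx] at h2
    omega
  obtain ⟨p, hp⟩ := v.surjective (WithZero.exp (-1))
  obtain ⟨q, hq⟩ := w.surjective (WithZero.exp (-1))
  have hp0 : p ≠ 0 := by rintro rfl; exact WithZero.exp_ne_zero (hp.symm.trans (map_zero _))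
  have hq0 : q ≠ 0 := by rintro rfl; exact WithZero.exp_ne_zero (hq.symm.trans (map_zero _))
  have hvp : v.ord p = 1 := by simp [ord, hp]
  have hwq : w.ord q = 1 := by simp [ord, hq]
  have hpow : ∀ (u : Place K F) (n : ℤ), u.ord (p ^ n) = n * u.ord p := by
    intro u n
    simp only [ord, map_zpow₀, WithZero.log_zpow, smul_eq_mul]
    ring
  -- Dividing `x` by a power of the uniformiser `p` gives a unit at `v`, hence at `w`. So the two
  -- orders are proportional, and surjectivity of `w` forces the factor to be 1.
  have key : ∀ x : F, x ≠ 0 → w.ord x = v.ord x * w.ord p := by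
    intro x hx
    have hpn : p ^ (-(v.ord x)) ≠ 0 := zpow_ne_zero _ hp0
    have h1 := hzero (x * p ^ (-(v.ord x))) (mul_ne_zero hx hpn)
      (by rw [v.ord_mul hx hpn, hpow, hvp]; ring)
    rw [w.ord_mul hx hpn, hpow] at h1
    linarith
  have hwp : 0 ≤ w.ord p := (hord p hp0).1 (by omega)
  have hwp1 : w.ord p = 1 := by
    have := key q hq0
    rw [hwq] at this
    exact Int.eq_one_of_mul_eq_one_left hwp this.symm
  refine ext_val (Valuation.ext fun x => ?_)
  by_cases hx : x = 0
  · simp [hx]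
  · rw [v.val_eq_exp hx, w.val_eq_exp hx, key x hx, hwp1, mul_one]

/-- The real absolute value `2 ^ (-ord_v)`. -/
def absoluteValue (v : Place K F) : AbsoluteValue F ℝ where
  toFun x := WithZeroMulInt.toNNReal (two_ne_zero : (2 : ℝ≥0) ≠ 0) (v.val x)
  map_mul' x y := by simp
  nonneg' x := NNReal.coe_nonneg _
  eq_zero' x := by
    rw [NNReal.coe_eq_zero, map_eq_zero, map_eq_zero]
  add_le' x y := by
    have hm := (WithZeroMulInt.toNNReal_strictMono (e := 2) one_lt_two).monotone
    rw [← NNReal.coe_add, NNReal.coe_le_coe]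
    refine (hm (v.val.map_add x y)).trans ?_
    rw [hm.map_max]
    exact max_le_add_of_nonneg zero_le zero_le

theorem absoluteValue_le_iff (v : Place K F) (x y : F) :
    v.absoluteValue x ≤ v.absoluteValue y ↔ v.val x ≤ v.val y := by
  have hm := WithZeroMulInt.toNNReal_strictMono (e := 2) one_lt_two
  exact NNReal.coe_le_coe.trans hm.le_iff_le

theorem absoluteValue_lt_iff (v : Place K F) (x y : F) :
    v.absoluteValue x < v.absoluteValue y ↔ v.val x < v.val y := by
  rw [← not_le, absoluteValue_le_iff, not_le]

/-- Weak approximation for a finite family of places. -/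
theorem exists_one_lt_lt_one {ι : Type*} [Finite ι] {v : ι → Place K F}
    (hv : Function.Injective v) (i : ι) :
    ∃ a, 1 < (v i).val a ∧ ∀ j, j ≠ i → (v j).val a < 1 := by
  have h1 : ∀ i, ((v i).absoluteValue).IsNontrivial := by
    intro i
    obtain ⟨p, hp⟩ := (v i).surjective (WithZero.exp (-1))
    have hp1 : (v i).val p < (v i).val 1 := by
      rw [hp, map_one, ← WithZero.exp_zero, WithZero.exp_lt_exp]
      omega
    refine ⟨p, by rintro rfl; exact WithZero.exp_ne_zero (hp.symm.trans (map_zero _)), ?_⟩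
    have := ((v i).absoluteValue_lt_iff p 1).2 hp1
    rw [map_one] at this
    exact this.ne
  have h2 : Pairwise fun i j => ¬ ((v i).absoluteValue).IsEquiv (v j).absoluteValue := by
    intro i j hij h
    refine hij (hv (eq_of_forall_val_le_one fun x => ?_))
    have := h x 1
    rwa [absoluteValue_le_iff, absoluteValue_le_iff, map_one, map_one] at this
  obtain ⟨a, ha, ha'⟩ := AbsoluteValue.exists_one_lt_lt_one_pi_of_not_isEquiv h1 h2 i
  refine ⟨a, ?_, fun j hj => ?_⟩
  · rwa [← map_one (v i).absoluteValue, absoluteValue_lt_iff, map_one] at ha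
  · have := ha' j hj
    rwa [← map_one (v j).absoluteValue, absoluteValue_lt_iff, map_one] at this

open Polynomial in
theorem val_aeval_le_one (v : Place K F) {f : F} (hf : v.val f ≤ 1) (p : K[X]) :
    v.val (aeval f p) ≤ 1 := by
  induction p using Polynomial.induction_on' with
  | add p q hp hq =>
    rw [map_add]
    exact (v.val.map_add _ _).trans (max_le hp hq)
  | monomial n a =>
    rw [aeval_monomial, map_mul, map_pow]
    exact mul_le_one' (v.val_algebraMap_le_one a) (pow_le_one' hf n)

open Polynomial in
theorem val_aeval_eq_one (v : Place K F) {f : F} (hf : v.val f < 1) {p : K[X]}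
    (hp : p.coeff 0 ≠ 0) : v.val (aeval f p) = 1 := by
  have h : aeval f p = f * aeval f (divX p) + algebraMap K F (p.coeff 0) := by
    have := congrArg (aeval f) (X_mul_divX_add p)
    rwa [map_add, map_mul, aeval_X, aeval_C, eq_comm] at this
  rw [h, ← v.trivial _ hp]
  refine Valuation.map_add_eq_of_lt_right _ ?_
  rw [v.trivial _ hp, map_mul]
  exact mul_lt_one_of_lt_of_le hf (v.val_aeval_le_one hf.le _)

open Polynomial in
-- A polynomial with nonzero constant term takes a value of valuation 1 at `f`. An algebraic
-- relation could therefore be divided by `X` indefinitely.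
theorem transcendental_of_val_lt_one (v : Place K F) {f : F} (hf : v.val f < 1) (hf0 : f ≠ 0) :
    Transcendental K f := by
  rintro ⟨p, hp0, hp⟩
  have hn : ∀ n, X ^ n ∣ p := by
    intro n
    induction n with
    | zero => simp
    | succ n ih =>
      obtain ⟨q, rfl⟩ := ih
      rw [map_mul, map_pow, aeval_X, mul_eq_zero_iff_left (pow_ne_zero _ hf0)] at hp
      rw [pow_succ]
      refine mul_dvd_mul_left _ (X_dvd_iff.2 ?_)
      by_contra h
      have := v.val_aeval_eq_one hf h
      simp [hp] at this
  have := natDegree_le_of_dvd (hn (p.natDegree + 1)) hp0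
  simp at this

open Polynomial in
/-- Elements that separate finitely many zeros of `f` are linearly independent over `K(f)`. -/
theorem linearIndependent_of_separating {ι : Type*} [Finite ι] {v : ι → Place K F} {f : F}
    (hf0 : f ≠ 0) (hf : ∀ i, (v i).val f < 1) {x : ι → F}
    (hx0 : ∀ i, x i ≠ 0) (hx : ∀ i j, j ≠ i → (v i).val (x j) < (v i).val (x i)) :
    LinearIndependent (IntermediateField.adjoin K {f}) x := by
  cases nonempty_fintype ι
  open scoped IntermediateField.algebraAdjoinAdjoin in
  rw [← LinearIndependent.iff_fractionRing (Algebra.adjoin K {f})]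
  rw [Fintype.linearIndependent_iff]
  intro g hg
  have hp : ∀ i, ∃ p : K[X], aeval f p = (g i : F) := by
    intro i
    have := (g i).2
    simp only [Algebra.adjoin_singleton_eq_range_aeval] at this
    exact this
  choose p hp using hp
  have hsum : ∑ i, aeval f (p i) * x i = 0 := by
    rw [← hg]
    refine Finset.sum_congr rfl fun i _ => ?_
    rw [hp i, Algebra.smul_def]
    rfl
  -- Infinite descent: after cancelling `f ^ n`, a nonzero constant term in the `i`-th coefficient
  -- would make the `i`-th summand strictly dominant at `v i`, so the sum could not vanish.
  have hdvd : ∀ n : ℕ, ∀ i, X ^ n ∣ p i := by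
    intro n
    induction n with
    | zero => simp
    | succ n ih =>
      choose q hq using ih
      have hsum' : ∑ i, aeval f (q i) * x i = 0 := by
        have : f ^ n * ∑ i, aeval f (q i) * x i = 0 := by
          rw [← hsum, Finset.mul_sum]
          refine Finset.sum_congr rfl fun i _ => ?_
          rw [hq i, map_mul, map_pow, aeval_X, mul_assoc]
        exact (mul_eq_zero.1 this).resolve_left (pow_ne_zero _ hf0)
      intro i
      rw [hq i, pow_succ]
      refine mul_dvd_mul_left _ (X_dvd_iff.2 ?_)
      by_contra h
      classical
      rw [← Finset.add_sum_erase _ _ (Finset.mem_univ i)] at hsum'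
      have hxi' : (v i).val (x i) ≠ 0 := (Valuation.ne_zero_iff _).2 (hx0 i)
      have h1 : (v i).val (∑ j ∈ Finset.univ.erase i, aeval f (q j) * x j) < (v i).val (x i) := by
        refine Valuation.map_sum_lt _ hxi' fun j hj => ?_
        rw [map_mul]
        exact (mul_le_of_le_one_left' ((v i).val_aeval_le_one (hf i).le _)).trans_lt
          (hx i j (Finset.ne_of_mem_erase hj))
      have h2 : (v i).val (aeval f (q i) * x i) = (v i).val (x i) := by
        rw [map_mul, (v i).val_aeval_eq_one (hf i) h, one_mul]
      rw [eq_neg_of_add_eq_zero_left hsum', Valuation.map_neg] at h2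
      exact h1.ne h2
  intro i
  rw [Subtype.ext_iff, ← hp i]
  by_cases h0 : p i = 0
  · simp [h0]
  · have := natDegree_le_of_dvd (hdvd ((p i).natDegree + 1) i) h0
    simp at this

theorem finiteDimensional_adjoin_of_transcendental [Algebra.EssFiniteType K F]
    (hF : Algebra.trdeg K F = 1) {f : F} (hf : Transcendental K f) :
    FiniteDimensional (IntermediateField.adjoin K {f}) F := by
  have h1 : AlgebraicIndependent K (fun i : ({f} : Set F) => (i : F)) := by
    rw [algebraicIndependent_unique_type_iff]
    exact hf
  have h2 := h1.isTranscendenceBasis_of_trdeg_le_of_finite (by rw [hF]; simp)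
  have h3 := h2.isAlgebraic_field
  rw [Subtype.range_coe] at h3
  have : Algebra.EssFiniteType (IntermediateField.adjoin K {f}) F :=
    Algebra.EssFiniteType.of_comp K _ F
  exact Algebra.finite_of_essFiniteType_of_isAlgebraic

/-- The degree of `F` over `K(f)` bounds the number of zeros of `f`: weak approximation supplies one
element per zero, and these elements are independent over `K(f)`. -/
theorem finite_setOf_val_lt_one [Algebra.EssFiniteType K F] (hF : Algebra.trdeg K F = 1) {f : F}
    (hf0 : f ≠ 0) : {v : Place K F | v.val f < 1}.Finite := by
  rcases Set.eq_empty_or_nonempty {v : Place K F | v.val f < 1} with h | ⟨v₀, hv₀⟩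
  · rw [h]
    exact Set.finite_empty
  have := finiteDimensional_adjoin_of_transcendental hF (v₀.transcendental_of_val_lt_one hv₀ hf0)
  by_contra hinf
  obtain ⟨t, hts, htc⟩ := Set.Infinite.exists_subset_card_eq hinf
    (Module.finrank (IntermediateField.adjoin K {f}) F + 1)
  choose x hx1 hx2 using
    exists_one_lt_lt_one (v := fun i : t => (i : Place K F)) Subtype.val_injective
  have hli := linearIndependent_of_separating (v := fun i : t => (i : Place K F)) hf0
    (fun i => hts i.2) (x := x)
    (fun i h => by simpa [h] using (hx1 i))
    (fun i j hij => (hx2 j i hij.symm).trans (hx1 i))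
  have := hli.fintype_card_le_finrank
  rw [Fintype.card_coe] at this
  omega

/-- A nonzero function on a curve has finitely many zeros and poles. -/
theorem finite_setOf_ord_ne_zero [Algebra.EssFiniteType K F] (hF : Algebra.trdeg K F = 1) {f : F}
    (hf0 : f ≠ 0) : {v : Place K F | v.ord f ≠ 0}.Finite := by
  refine ((finite_setOf_val_lt_one hF hf0).union
    (finite_setOf_val_lt_one hF (inv_ne_zero hf0))).subset fun v hv => ?_
  rcases lt_or_gt_of_ne hv with h | h
  · right
    exact (v.val_lt_one_iff (inv_ne_zero hf0)).2 (by rw [v.ord_inv hf0]; omega)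
  · left
    exact (v.val_lt_one_iff hf0).2 h

end Place

/-! ### Simplicial cones, coordinates and Cartier data -/

namespace SimplicialFan

open Filter

variable {n : ℕ} {ι : Type*} [Fintype ι] (X : SimplicialFan n ι)

/-- The generator of the ray `ρ` in `N_ℝ`. -/
def vec (ρ : ι) : Fin n → ℝ := fun i => (X.u ρ i : ℝ)

variable {X}

theorem mem_coneOf_iff {S : Set ι} {x : Fin n → ℝ} :
    x ∈ coneOf X.u S ↔
      ∃ c : ι → ℝ, (∀ ρ, 0 ≤ c ρ) ∧ (∀ ρ, ρ ∉ S → c ρ = 0) ∧ x = ∑ ρ, c ρ • X.vec ρ := by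
  refine exists_congr fun c => and_congr Iff.rfl (and_congr Iff.rfl ?_)
  simp [funext_iff, vec, Finset.sum_apply]

theorem coneOf_mono {S T : Set ι} (h : S ⊆ T) : coneOf X.u S ⊆ coneOf X.u T := by
  rintro x ⟨c, h0, hc, hx⟩
  exact ⟨c, h0, fun ρ hρ => hc ρ fun h' => hρ (h h'), hx⟩

theorem sum_eq_sum_subtype {M : Type*} [AddCommMonoid M] {σ : Finset ι} {f : ι → M}
    (hf : ∀ ρ, ρ ∉ σ → f ρ = 0) : ∑ ρ, f ρ = ∑ ρ : {ρ // ρ ∈ σ}, f ρ := by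
  rw [Finset.sum_coe_sort σ f]
  exact (Finset.sum_subset (Finset.subset_univ σ) fun ρ _ h => hf ρ h).symm

/-- The coefficients of a vector in terms of the generators of a cone are unique. -/
theorem coeff_unique {σ : Finset ι} (hσ : σ ∈ X.cones) {c d : ι → ℝ}
    (hc : ∀ ρ, ρ ∉ σ → c ρ = 0) (hd : ∀ ρ, ρ ∉ σ → d ρ = 0)
    (h : ∑ ρ, c ρ • X.vec ρ = ∑ ρ, d ρ • X.vec ρ) : c = d := by
  have hli := X.linearIndependent σ hσ
  rw [Fintype.linearIndependent_iff] at hli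
  rw [sum_eq_sum_subtype (σ := σ) fun ρ hρ => by rw [hc ρ hρ, zero_smul],
    sum_eq_sum_subtype (σ := σ) fun ρ hρ => by rw [hd ρ hρ, zero_smul]] at h
  have := hli (fun ρ => c ρ - d ρ) (by
    simp only [sub_smul, Finset.sum_sub_distrib]
    exact sub_eq_zero.2 h)
  funext ρ
  by_cases hρ : ρ ∈ σ
  · exact sub_eq_zero.1 (this ⟨ρ, hρ⟩)
  · rw [hc ρ hρ, hd ρ hρ]

/-- If two cones share a point, its support in the first one is contained in the second one. -/
theorem mem_of_coeff_ne_zero {σ τ : Finset ι} (hσ : σ ∈ X.cones) (hτ : τ ∈ X.cones) {c : ι → ℝ}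
    (h0 : ∀ ρ, 0 ≤ c ρ) (hc : ∀ ρ, ρ ∉ σ → c ρ = 0) (hx : ∑ ρ, c ρ • X.vec ρ ∈ X.cone τ) {ρ : ι}
    (hρ : c ρ ≠ 0) : ρ ∈ τ := by
  obtain ⟨d, _, hd, hcd⟩ := mem_coneOf_iff.1
    (X.inter_subset σ hσ τ hτ ⟨mem_coneOf_iff.2 ⟨c, h0, fun ρ h => hc ρ h, rfl⟩, hx⟩)
  have := coeff_unique hσ hc (fun ρ h => hd ρ fun h' => h h'.1) hcd
  by_contra h
  exact hρ (this ▸ hd ρ fun h' => h h'.2)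

/-- The sum of the generators of `γ` is a relative interior point of `γ`. The lemma turns limit
arguments into incidences between cones. -/
theorem subset_of_sum_mem {γ σ τ : Finset ι} (hσ : σ ∈ X.cones) (hτ : τ ∈ X.cones) (hγ : γ ⊆ σ)
    (hx : ∑ ρ ∈ γ, X.vec ρ ∈ X.cone τ) : γ ⊆ τ := by
  classical
  intro ρ hρ
  refine mem_of_coeff_ne_zero (c := fun ρ => if ρ ∈ γ then 1 else 0) hσ hτ
    (fun ρ => by split_ifs <;> norm_num) (fun ρ h => if_neg fun h' => h (hγ h')) ?_ (ρ := ρ)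
    (by simp [hρ])
  simpa [ite_smul, Finset.sum_ite_mem] using hx

theorem card_le {σ : Finset ι} (hσ : σ ∈ X.cones) : σ.card ≤ n := by
  have := (X.linearIndependent σ hσ).fintype_card_le_finrank
  simpa using this

/-- Two linear maps that agree on the generators of a full-dimensional cone are equal. -/
theorem linearMap_ext {σ : Finset ι} (hσ : σ ∈ X.maxCones) {M : Type*} [AddCommGroup M]
    [Module ℝ M] {f g : (Fin n → ℝ) →ₗ[ℝ] M} (h : ∀ ρ ∈ σ, f (X.vec ρ) = g (X.vec ρ)) :
    f = g := by
  have hspan := (X.linearIndependent σ hσ.1).span_eq_top_of_card_eq_finrank' (by simp [hσ.2])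
  refine LinearMap.ext_on hspan ?_
  rintro _ ⟨ρ, rfl⟩
  exact h ρ ρ.2

/-- The linear form `⟨m, ·⟩` on `N_ℝ` of `m ∈ M_ℚ`. -/
def pairing (m : Fin n → ℚ) : (Fin n → ℝ) →ₗ[ℝ] ℝ := dotProductBilin ℝ ℝ fun i => (m i : ℝ)

theorem pairing_apply (m : Fin n → ℚ) (x : Fin n → ℝ) : pairing m x = (fun i => (m i : ℝ)) ⬝ᵥ x :=
  rfl

theorem pairing_ratCast (m x : Fin n → ℚ) :
    pairing m (fun i => (x i : ℝ)) = ((m ⬝ᵥ x : ℚ) : ℝ) := by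
  simp [pairing_apply, dotProduct]

theorem pairing_vec (m : Fin n → ℚ) (ρ : ι) :
    pairing m (X.vec ρ) = ((m ⬝ᵥ (fun i => (X.u ρ i : ℚ)) : ℚ) : ℝ) := by
  simp [pairing_apply, dotProduct, vec]

theorem pairing_intCast (m : Fin n → ℚ) (w : Fin n → ℤ) :
    pairing m (fun i => (w i : ℝ)) = ((m ⬝ᵥ (fun i => (w i : ℚ)) : ℚ) : ℝ) := by
  rw [← pairing_ratCast]
  simp

theorem pairing_injective : Function.Injective (pairing (n := n)) := by
  intro a b h
  funext i
  have := LinearMap.congr_fun h (Pi.single i 1)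
  simpa [pairing_apply] using this

/-- Independence of the generators descends from `ℝ` to `ℚ`, so a rational linear form with
prescribed values on them exists, and the choice made in `cartierDatum` is a genuine one. -/
theorem cartierDatum_spec {σ : Finset ι} (hσ : σ ∈ X.cones) (D : ι → ℤ) :
    ∀ ρ ∈ σ, (X.cartierDatum D σ ⬝ᵥ fun i => (X.u ρ i : ℚ)) = -(D ρ : ℚ) := by
  refine Classical.epsilon_spec (p := fun m : Fin n → ℚ => ∀ ρ ∈ σ,
    (m ⬝ᵥ fun i => (X.u ρ i : ℚ)) = -(D ρ : ℚ)) ?_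
  have hli : LinearIndependent ℚ (fun (ρ : {ρ // ρ ∈ σ}) (i : Fin n) => (X.u ρ i : ℚ)) := by
    have h := (X.linearIndependent σ hσ).restrict_scalars' ℚ
    refine LinearIndependent.of_comp ((Algebra.linearMap ℚ ℝ).compLeft (Fin n)) ?_
    convert h using 2
    ext i
    simp
  obtain ⟨g, hg⟩ := LinearMap.exists_leftInverse_of_injective _
    (LinearMap.ker_eq_bot.2 hli.finsuppLinearCombination_injective)
  let f : (Fin n → ℚ) →ₗ[ℚ] ℚ :=
    (Finsupp.linearCombination ℚ fun ρ : {ρ // ρ ∈ σ} => -(D ρ : ℚ)).comp g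
  refine ⟨fun i => f (Pi.single i 1), fun ρ hρ => ?_⟩
  have h1 : g (fun i => (X.u ρ i : ℚ)) = Finsupp.single ⟨ρ, hρ⟩ 1 := by
    have := LinearMap.congr_fun hg (Finsupp.single ⟨ρ, hρ⟩ 1)
    simpa using this
  have h2 : f (fun i => (X.u ρ i : ℚ)) = -(D ρ : ℚ) := by
    simp [f, h1]
  rw [← h2, LinearMap.pi_apply_eq_sum_univ f]
  refine Finset.sum_congr rfl fun i _ => ?_
  rw [smul_eq_mul, mul_comm]
  congr 1
  refine congrArg f (funext fun j => ?_)
  simp [Pi.single_apply, eq_comm]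

theorem pairing_cartierDatum {σ : Finset ι} (hσ : σ ∈ X.cones) (D : ι → ℤ) {ρ : ι} (hρ : ρ ∈ σ) :
    pairing (X.cartierDatum D σ) (X.vec ρ) = -(D ρ : ℝ) := by
  rw [pairing_vec, cartierDatum_spec hσ D ρ hρ]
  simp

/-- Uniqueness of the Cartier datum. -/
theorem pairing_cartierDatum_eq {σ : Finset ι} (hσ : σ ∈ X.maxCones) {D : ι → ℤ}
    {f : (Fin n → ℝ) →ₗ[ℝ] ℝ} (hf : ∀ ρ ∈ σ, f (X.vec ρ) = -(D ρ : ℝ)) :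
    pairing (X.cartierDatum D σ) = f :=
  linearMap_ext hσ fun ρ hρ => by rw [pairing_cartierDatum hσ.1 D hρ, hf ρ hρ]

variable (X) in
/-- The coordinate at `ρ` with respect to the generators of `σ`. -/
def coord (σ : Finset ι) (ρ : ι) : (Fin n → ℝ) →ₗ[ℝ] ℝ :=
  -pairing (X.cartierDatum (rayDivisor ρ) σ)

open scoped Classical in
theorem coord_vec {σ : Finset ι} (hσ : σ ∈ X.cones) (ρ : ι) {τ : ι} (hτ : τ ∈ σ) :
    X.coord σ ρ (X.vec τ) = if τ = ρ then 1 else 0 := by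
  rw [coord, LinearMap.neg_apply, pairing_cartierDatum hσ _ hτ, neg_neg, rayDivisor,
    Pi.single_apply]
  split_ifs <;> simp

theorem coord_eq_zero {σ : Finset ι} (hσ : σ ∈ X.maxCones) {ρ : ι} (hρ : ρ ∉ σ) :
    X.coord σ ρ = 0 := by
  classical
  refine linearMap_ext hσ fun τ hτ => ?_
  rw [coord_vec hσ.1 ρ hτ, if_neg (by rintro rfl; exact hρ hτ), LinearMap.zero_apply]

theorem sum_coord_smul_vec {σ : Finset ι} (hσ : σ ∈ X.maxCones) (x : Fin n → ℝ) :
    ∑ ρ, X.coord σ ρ x • X.vec ρ = x := by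
  classical
  have : ∑ ρ, (X.coord σ ρ).smulRight (X.vec ρ) = LinearMap.id := by
    refine linearMap_ext hσ fun τ hτ => ?_
    simp [LinearMap.sum_apply, coord_vec hσ.1 _ hτ]
  simpa [LinearMap.sum_apply] using LinearMap.congr_fun this x

theorem mem_cone_iff {σ : Finset ι} (hσ : σ ∈ X.maxCones) {x : Fin n → ℝ} :
    x ∈ X.cone σ ↔ ∀ ρ, 0 ≤ X.coord σ ρ x := by
  refine ⟨fun h => ?_, fun h => mem_coneOf_iff.2 ⟨fun ρ => X.coord σ ρ x, h, fun ρ hρ => ?_, ?_⟩⟩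
  · obtain ⟨c, h0, hc, rfl⟩ := mem_coneOf_iff.1 h
    have := coeff_unique hσ.1 (fun ρ hρ => by rw [coord_eq_zero hσ hρ]; rfl) hc
      (sum_coord_smul_vec hσ (∑ ρ, c ρ • X.vec ρ))
    intro ρ
    have h1 := congrFun this ρ
    rw [h1]
    exact h0 ρ
  · dsimp only
    rw [coord_eq_zero hσ hρ]
    rfl
  · rw [sum_coord_smul_vec hσ]

theorem isClosed_cone {σ : Finset ι} (hσ : σ ∈ X.maxCones) : IsClosed (X.cone σ) := by
  have : X.cone σ = ⋂ ρ, {x | 0 ≤ X.coord σ ρ x} := by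
    ext x
    simp [mem_cone_iff hσ]
  rw [this]
  exact isClosed_iInter fun ρ =>
    isClosed_le continuous_const (X.coord σ ρ).continuous_of_finiteDimensional

theorem cartierDatum_eq_sum {σ : Finset ι} (hσ : σ ∈ X.maxCones) (D : ι → ℤ) :
    X.cartierDatum D σ = ∑ ρ, (D ρ : ℚ) • X.cartierDatum (rayDivisor ρ) σ := by
  classical
  refine pairing_injective (pairing_cartierDatum_eq hσ fun τ hτ => ?_)
  rw [pairing_vec, sum_dotProduct]
  simp only [smul_dotProduct, cartierDatum_spec hσ.1 _ τ hτ, rayDivisor, Pi.single_apply]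
  simp

/-! ### Completeness: full-dimensional cones and their neighbours -/

/-- A sequence has infinitely many terms in some cone of a complete fan. -/
theorem IsComplete.exists_frequently_mem_cone (hX : X.IsComplete) (x : ℕ → Fin n → ℝ) :
    ∃ σ ∈ X.cones, ∃ᶠ k in atTop, x k ∈ X.cone σ := by
  by_contra! h
  have h' : ∀ σ : Finset ι, ∀ᶠ k in atTop, σ ∈ X.cones → x k ∉ X.cone σ := by
    intro σ
    by_cases hσ : σ ∈ X.cones
    · filter_upwards [h σ hσ] with k hk _ using hk
    · exact Eventually.of_forall fun k hk => absurd hk hσ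
  obtain ⟨k, hk⟩ := (eventually_all.2 h').exists
  obtain ⟨σ, hσ, hxσ⟩ := hX (x k)
  exact hk σ hσ hxσ

/-- There is a vector outside the spans of the cones that are not full-dimensional. -/
theorem exists_generic (X : SimplicialFan n ι) : ∃ q : Fin n → ℝ, ∀ σ ∈ X.cones, σ ∉ X.maxCones →
    q ∉ Submodule.span ℝ (X.vec '' σ) := by
  classical
  let s : Finset (Submodule ℝ (Fin n → ℝ)) := (Finset.univ.filter
    fun σ : Finset ι => σ ∈ X.cones ∧ σ ∉ X.maxCones).image fun σ : Finset ι =>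
      Submodule.span ℝ (X.vec '' σ)
  -- Fewer than `n` generators span a proper subspace, and finitely many proper subspaces cannot
  -- cover a real vector space.
  have hs : ⊤ ∉ s := by
    intro h
    obtain ⟨σ, hσ, htop⟩ := Finset.mem_image.1 h
    rw [Finset.mem_filter] at hσ
    refine hσ.2.2 ⟨hσ.2.1, le_antisymm (card_le hσ.2.1) ?_⟩
    have h1 := finrank_span_finset_le_card (R := ℝ) (σ.image X.vec)
    rw [Finset.coe_image, Set.finrank, htop, finrank_top, Module.finrank_fin_fun] at h1
    exact h1.trans Finset.card_image_le
  have := Subspace.biUnion_ne_univ_of_top_notMem hs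
  rw [Set.ne_univ_iff_exists_notMem] at this
  obtain ⟨q, hq⟩ := this
  refine ⟨q, fun σ hσ hσ' hqσ => hq ?_⟩
  exact Set.mem_biUnion (Finset.mem_image.2 ⟨σ, by simp [hσ, hσ'], rfl⟩) hqσ

theorem cone_subset_span (σ : Finset ι) :
    X.cone σ ⊆ Submodule.span ℝ (X.vec '' σ) := by
  intro x hx
  obtain ⟨c, _, hc, rfl⟩ := mem_coneOf_iff.1 hx
  refine Submodule.sum_mem _ fun ρ _ => ?_
  by_cases hρ : ρ ∈ σ
  · exact Submodule.smul_mem _ _ (Submodule.subset_span ⟨ρ, hρ, rfl⟩)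
  · rw [hc ρ (by simpa using hρ), zero_smul]
    exact Submodule.zero_mem _

/-- In a complete fan, every cone is a face of a full-dimensional one. -/
theorem IsComplete.exists_maxCone (hX : X.IsComplete) {γ : Finset ι} (hγ : γ ∈ X.cones) :
    ∃ σ ∈ X.maxCones, γ ⊆ σ := by
  obtain ⟨q, hq⟩ := X.exists_generic
  let p := ∑ ρ ∈ γ, X.vec ρ
  -- An interior point of `γ` is perturbed in a generic direction, with the perturbation tending to
  -- zero.
  obtain ⟨σ, hσ, hf⟩ :=
    hX.exists_frequently_mem_cone fun k => p + (1 / ((k : ℝ) + 1)) • q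
  have hmax : σ ∈ X.maxCones := by
    by_contra h
    obtain ⟨k, hk⟩ := hf.exists
    obtain ⟨l, hl, hkl⟩ := (hf.and_eventually (eventually_gt_atTop k)).exists
    -- Two of the perturbed points in the same cone differ by a nonzero multiple of `q`, against
    -- genericity.
    have h1 := Submodule.sub_mem _ (cone_subset_span σ hk) (cone_subset_span σ hl)
    rw [add_sub_add_left_eq_sub, ← sub_smul] at h1
    refine hq σ hσ h ((Submodule.smul_mem_iff _ ?_).1 h1)
    have : 1 / ((l : ℝ) + 1) < 1 / ((k : ℝ) + 1) := by
      apply one_div_lt_one_div_of_lt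
      · positivity
      · exact_mod_cast Nat.succ_lt_succ hkl
    linarith
  refine ⟨σ, hmax, subset_of_sum_mem hγ hσ (subset_refl _) ?_⟩
  have hlim : Tendsto (fun k : ℕ => p + (1 / ((k : ℝ) + 1)) • q) atTop (𝓝 (p + (0 : ℝ) • q)) :=
    (tendsto_one_div_add_atTop_nhds_zero_nat.smul_const q).const_add p
  rw [zero_smul, add_zero] at hlim
  exact (isClosed_cone hmax).mem_of_frequently_of_tendsto hf hlim

theorem IsComplete.exists_frequently_mem_maxCone (hX : X.IsComplete) (x : ℕ → Fin n → ℝ) :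
    ∃ σ ∈ X.maxCones, ∃ᶠ k in atTop, x k ∈ X.cone σ := by
  obtain ⟨σ, hσ, hf⟩ := hX.exists_frequently_mem_cone x
  obtain ⟨τ, hτ, hστ⟩ := hX.exists_maxCone hσ
  exact ⟨τ, hτ, hf.mono fun k hk => coneOf_mono (by exact_mod_cast hστ) hk⟩

open scoped Classical in
/-- Every facet of a full-dimensional cone of a complete fan is a face of a full-dimensional cone
on the other side. -/
theorem IsComplete.exists_adjacent (hX : X.IsComplete) {σ : Finset ι} (hσ : σ ∈ X.maxCones) {i : ι}
    (hi : i ∈ σ) :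
    ∃ κ, κ ∉ σ ∧ insert κ (σ.erase i) ∈ X.maxCones ∧ X.coord σ i (X.vec κ) < 0 := by
  let p := ∑ ρ ∈ σ.erase i, X.vec ρ
  -- Points approaching the interior of the facet from its far side: a cone containing infinitely
  -- many of them contains the facet in the limit, and its extra ray is `κ`.
  obtain ⟨τ, hτ, hf⟩ :=
    hX.exists_frequently_mem_maxCone fun k => p + (1 / ((k : ℝ) + 1)) • (-X.vec i)
  have hlim : Tendsto (fun k : ℕ => p + (1 / ((k : ℝ) + 1)) • (-X.vec i)) atTop
      (𝓝 (p + (0 : ℝ) • (-X.vec i))) :=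
    (tendsto_one_div_add_atTop_nhds_zero_nat.smul_const _).const_add p
  rw [zero_smul, add_zero] at hlim
  have hsub : σ.erase i ⊆ τ := subset_of_sum_mem hσ.1 hτ.1 (Finset.erase_subset _ _)
    ((isClosed_cone hτ).mem_of_frequently_of_tendsto hf hlim)
  obtain ⟨k, hk⟩ := hf.exists
  set x := p + (1 / ((k : ℝ) + 1)) • (-X.vec i) with hx
  have hneg : X.coord σ i x < 0 := by
    have hp : X.coord σ i p = 0 := by
      rw [map_sum]
      refine Finset.sum_eq_zero fun ρ hρ => ?_
      rw [coord_vec hσ.1 i (Finset.mem_of_mem_erase hρ), if_neg (Finset.ne_of_mem_erase hρ)]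
    rw [hx, map_add, hp, map_smul, map_neg, coord_vec hσ.1 i hi, if_pos rfl]
    have : 0 < 1 / ((k : ℝ) + 1) := by positivity
    simpa using this
  rw [← sum_coord_smul_vec hτ x, map_sum] at hneg
  obtain ⟨κ, -, hκ⟩ := Finset.exists_lt_of_sum_lt (hneg.trans_eq Finset.sum_const_zero.symm)
  rw [map_smul, smul_eq_mul] at hκ
  have hκ0 := (mem_cone_iff hτ).1 hk κ
  have hκ1 : X.coord σ i (X.vec κ) < 0 := by
    by_contra! h
    exact hκ.not_ge (mul_nonneg hκ0 h)
  have hκσ : κ ∉ σ := by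
    intro h
    rw [coord_vec hσ.1 i h] at hκ1
    split_ifs at hκ1 <;> norm_num at hκ1
  have hκτ : κ ∈ τ := by
    by_contra h
    rw [coord_eq_zero hτ h] at hκ
    simp at hκ
  refine ⟨κ, hκσ, ?_, hκ1⟩
  have hcard : (insert κ (σ.erase i)).card = n := by
    rw [Finset.card_insert_of_notMem fun h => hκσ (Finset.mem_of_mem_erase h),
      Finset.card_erase_add_one hi, hσ.2]
  rwa [Finset.eq_of_subset_of_card_le (Finset.insert_subset hκτ hsub) (by rw [hcard, hτ.2])]

open scoped Classical in
/-- There is only one full-dimensional cone on each side of a wall. -/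
theorem eq_of_same_side {τ : Finset ι} {i κ : ι} (hiτ : i ∉ τ) (hκτ : κ ∉ τ)
    (hσ : insert i τ ∈ X.maxCones) (hσ' : insert κ τ ∈ X.maxCones)
    (h : 0 < X.coord (insert i τ) i (X.vec κ)) : κ = i := by
  set σ := insert i τ
  -- `N` is large enough that `u_κ + N ∑_{μ ∈ τ} u_μ` has nonnegative coordinates in `σ`. This point
  -- lies in both cones, which forces `κ` into `σ`.
  let N := ∑ ρ, |X.coord σ ρ (X.vec κ)|
  have hN : 0 ≤ N := Finset.sum_nonneg fun _ _ => abs_nonneg _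
  let c : ι → ℝ := fun ρ => (if ρ = κ then 1 else 0) + if ρ ∈ τ then N else 0
  have hsum : ∑ ρ, c ρ • X.vec ρ = X.vec κ + ∑ ρ ∈ τ, N • X.vec ρ := by
    simp [c, add_smul, Finset.sum_add_distrib, ite_smul, Finset.sum_ite_mem]
  have hmem : κ ∈ σ := by
    refine mem_of_coeff_ne_zero (c := c) hσ'.1 hσ.1 (fun ρ => ?_) (fun ρ hρ => ?_) ?_ (ρ := κ)
      (by simp [c, hκτ])
    · refine add_nonneg ?_ ?_ <;> split_ifs <;> norm_num [hN]
    · rw [Finset.mem_insert, not_or] at hρ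
      simp [c, hρ.1, hρ.2]
    · rw [hsum, mem_cone_iff hσ]
      intro ρ
      by_cases hρ : ρ ∈ σ
      · rw [map_add, map_sum]
        rcases Finset.mem_insert.1 hρ with rfl | hρτ
        · refine add_nonneg h.le (Finset.sum_nonneg fun μ hμ => ?_)
          rw [map_smul, coord_vec hσ.1 _ (Finset.mem_insert_of_mem hμ)]
          split_ifs <;> simp [hN]
        · have h1 : ∑ μ ∈ τ, X.coord σ ρ (N • X.vec μ) = N := by
            rw [Finset.sum_eq_single_of_mem ρ hρτ, map_smul, coord_vec hσ.1 _ hρ]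
            · simp
            · intro μ hμ hμρ
              rw [map_smul, coord_vec hσ.1 _ (Finset.mem_insert_of_mem hμ), if_neg hμρ, smul_zero]
          rw [h1]
          have h2 : |X.coord σ ρ (X.vec κ)| ≤ N :=
            Finset.single_le_sum (f := fun ρ => |X.coord σ ρ (X.vec κ)|)
              (fun _ _ => abs_nonneg _) (Finset.mem_univ ρ)
          have h3 := neg_abs_le (X.coord σ ρ (X.vec κ))
          linarith
      · rw [coord_eq_zero hσ hρ]
        rfl
  exact (Finset.mem_insert.1 hmem).resolve_right hκτ

/-! ### Relations among the ray generators -/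

open scoped Classical in
variable (X) in
/-- The linear relation that expresses `u_ρ` in the generators of `σ`. -/
def rel (σ : Finset ι) (ρ : ι) : ι → ℝ :=
  fun κ => (if κ = ρ then 1 else 0) - X.coord σ κ (X.vec ρ)

theorem rel_eq_zero {σ : Finset ι} (hσ : σ ∈ X.cones) {ρ : ι} (hρ : ρ ∈ σ) : X.rel σ ρ = 0 := by
  classical
  funext κ
  simp only [rel, coord_vec hσ κ hρ, eq_comm, sub_self, Pi.zero_apply]

/-- Expand `x` in the generators of `σ` and take coordinates in `τ`. For `x` in the cone `σ` the
weights are nonnegative, which is where positivity of intersection numbers originates. -/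
theorem coord_sub_coord {σ τ : Finset ι} (hσ : σ ∈ X.maxCones) (x : Fin n → ℝ) (κ : ι) :
    X.coord σ κ x - X.coord τ κ x = ∑ ρ, X.coord σ ρ x * X.rel τ ρ κ := by
  classical
  conv_lhs => rw [← sum_coord_smul_vec hσ x, map_sum (X.coord τ κ)]
  rw [sum_coord_smul_vec hσ x]
  simp [rel, mul_sub, Finset.sum_sub_distrib]

theorem rel_sub_rel {σ τ : Finset ι} (hσ : σ ∈ X.maxCones) (ρ : ι) :
    X.rel τ ρ = X.rel σ ρ + ∑ μ, X.coord σ μ (X.vec ρ) • X.rel τ μ := by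
  funext κ
  have := coord_sub_coord (τ := τ) hσ (X.vec ρ) κ
  simp only [Pi.add_apply, Finset.sum_apply, Pi.smul_apply, smul_eq_mul]
  rw [← this, rel, rel]
  ring

/-- The pairing of the class of an ample divisor with `rel σ ρ` is positive. -/
theorem IsAmple.sum_mul_rel_pos {D : ι → ℤ} (hD : X.IsAmple D) {σ : Finset ι}
    (hσ : σ ∈ X.maxCones) {ρ : ι} (hρ : ρ ∉ σ) : 0 < ∑ κ, (D κ : ℝ) * X.rel σ ρ κ := by
  classical
  obtain ⟨k, hk, h⟩ := hD
  obtain ⟨m, hm, hm'⟩ := h σ hσ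
  let f : (Fin n → ℝ) →ₗ[ℝ] ℝ := dotProductBilin ℝ ℝ fun i => (m i : ℝ)
  have hf : ∀ ρ, f (X.vec ρ) = ((m ⬝ᵥ X.u ρ : ℤ) : ℝ) := by
    intro ρ
    simp [f, vec, dotProduct]
  -- The Cartier datum of `kD` written in the dual basis of `σ`. Consequently `kD` pairs with the
  -- relation to give `k D_ρ + ⟨m, u_ρ⟩`, the slack in the ampleness inequality.
  have h1 : f = -∑ κ, ((k : ℝ) * D κ) • X.coord σ κ := by
    refine linearMap_ext hσ fun τ hτ => ?_
    rw [hf, hm τ hτ]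
    simp [LinearMap.sum_apply, coord_vec hσ.1 _ hτ]
  have h2 : (k : ℝ) * ∑ κ, (D κ : ℝ) * X.rel σ ρ κ = k * D ρ + f (X.vec ρ) := by
    rw [h1]
    simp [rel, mul_sub, Finset.sum_sub_distrib, LinearMap.sum_apply, Finset.mul_sum, mul_assoc]
    ring
  have h3 : (0 : ℝ) < k * D ρ + f (X.vec ρ) := by
    rw [hf]
    have := hm' ρ hρ
    have : (0 : ℤ) < k * D ρ + m ⬝ᵥ X.u ρ := by linarith
    exact_mod_cast this
  rw [← h2] at h3
  exact pos_of_mul_pos_right h3 (by positivity)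

/-! ### Walls and the descent across them -/

open scoped Classical in
variable (X) in
/-- `σ` and the cone obtained from it by exchanging the ray `i` for `κ` are full-dimensional cones
on opposite sides of their common facet. -/
def IsWall (σ : Finset ι) (i κ : ι) : Prop :=
  σ ∈ X.maxCones ∧ i ∈ σ ∧ κ ∉ σ ∧ insert κ (σ.erase i) ∈ X.maxCones ∧
    X.coord σ i (X.vec κ) < 0

namespace IsWall

open scoped Classical in
theorem mem_erase_of_coord_ne_zero {σ : Finset ι} {i κ : ι} (h : X.IsWall σ i κ) {x : Fin n → ℝ}
    {μ : ι} (h0 : X.coord (insert κ (σ.erase i)) μ x ≠ 0) (hμ : μ ≠ κ) : μ ∈ σ.erase i := by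
  by_contra h'
  refine h0 ?_
  rw [coord_eq_zero h.2.2.2.1 fun h'' => h' ((Finset.mem_insert.1 h'').resolve_left hμ)]
  rfl

open scoped Classical in
-- The shared generators have vanishing `i`-coordinate, so only `κ` survives. The coordinates
-- transverse to the wall, measured from its two sides, are thus proportional with a negative
-- factor.
theorem coord_eq {σ : Finset ι} {i κ : ι} (h : X.IsWall σ i κ) (x : Fin n → ℝ) :
    X.coord σ i x = X.coord (insert κ (σ.erase i)) κ x * X.coord σ i (X.vec κ) := by
  conv_lhs => rw [← sum_coord_smul_vec h.2.2.2.1 x, map_sum]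
  rw [Finset.sum_eq_single κ]
  · simp
  · intro μ _ hμ
    by_cases h0 : X.coord (insert κ (σ.erase i)) μ x = 0
    · simp [h0]
    · have := h.mem_erase_of_coord_ne_zero h0 hμ
      rw [map_smul, coord_vec h.1.1 i (Finset.mem_of_mem_erase this),
        if_neg (Finset.ne_of_mem_erase this), smul_zero]
  · simp

open scoped Classical in
theorem sum_coord_smul_rel {σ : Finset ι} {i κ : ι} (h : X.IsWall σ i κ) (x : Fin n → ℝ) :
    ∑ μ, X.coord (insert κ (σ.erase i)) μ x • X.rel σ μ =
      X.coord (insert κ (σ.erase i)) κ x • X.rel σ κ := by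
  rw [Finset.sum_eq_single κ]
  · intro μ _ hμ
    by_cases h0 : X.coord (insert κ (σ.erase i)) μ x = 0
    · simp [h0]
    · rw [rel_eq_zero h.1.1 (Finset.mem_of_mem_erase (h.mem_erase_of_coord_ne_zero h0 hμ)),
        smul_zero]
  · simp

open scoped Classical in
-- The descent step: crossing the wall alters the relation of `u_ρ` by a multiple of the wall
-- relation, a positive multiple when `u_ρ` lies beyond the wall (`coord_pos`).
theorem rel_eq {σ : Finset ι} {i κ : ι} (h : X.IsWall σ i κ) (ρ : ι) :
    X.rel σ ρ = X.rel (insert κ (σ.erase i)) ρ +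
      X.coord (insert κ (σ.erase i)) κ (X.vec ρ) • X.rel σ κ := by
  rw [rel_sub_rel h.2.2.2.1 ρ, h.sum_coord_smul_rel]

open scoped Classical in
theorem coord_pos {σ : Finset ι} {i κ : ι} (h : X.IsWall σ i κ) {x : Fin n → ℝ}
    (hx : X.coord σ i x < 0) : 0 < X.coord (insert κ (σ.erase i)) κ x := by
  by_contra! h'
  rw [h.coord_eq] at hx
  exact hx.not_ge (mul_nonneg_of_nonpos_of_nonpos h' h.2.2.2.2.le)

open scoped Classical in
theorem erase_insert {σ : Finset ι} {i κ : ι} (h : X.IsWall σ i κ) :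
    (insert κ (σ.erase i)).erase κ = σ.erase i :=
  Finset.erase_insert fun h' => h.2.2.1 (Finset.mem_of_mem_erase h')

open scoped Classical in
theorem insert_erase {σ : Finset ι} {i κ : ι} (h : X.IsWall σ i κ) :
    insert i ((insert κ (σ.erase i)).erase κ) = σ := by
  rw [h.erase_insert, Finset.insert_erase h.2.1]

open scoped Classical in
theorem coord_neg {σ : Finset ι} {i κ : ι} (h : X.IsWall σ i κ) :
    X.coord (insert κ (σ.erase i)) κ (X.vec i) < 0 := by
  have h1 := h.coord_eq (X.vec i)
  rw [coord_vec h.1.1 i h.2.1, if_pos rfl] at h1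
  by_contra! h2
  have := mul_nonpos_of_nonneg_of_nonpos h2 h.2.2.2.2.le
  linarith

open scoped Classical in
theorem symm {σ : Finset ι} {i κ : ι} (h : X.IsWall σ i κ) :
    X.IsWall (insert κ (σ.erase i)) κ i := by
  refine ⟨h.2.2.2.1, Finset.mem_insert_self _ _, fun h' => ?_, ?_, h.coord_neg⟩
  · rcases Finset.mem_insert.1 h' with rfl | h'
    · exact h.2.2.1 h.2.1
    · exact Finset.notMem_erase _ _ h'
  · rw [h.insert_erase]
    exact h.1

/-- The relations on both sides of a wall agree up to a positive factor. -/
theorem rel_symm {σ : Finset ι} {i κ : ι} (h : X.IsWall σ i κ) :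
    ∃ a : ℝ, 0 < a ∧
      X.rel (open scoped Classical in insert κ (σ.erase i)) i = a • X.rel σ κ := by
  classical
  refine ⟨_, neg_pos.2 h.coord_neg, ?_⟩
  have := h.rel_eq i
  rw [rel_eq_zero h.1.1 h.2.1] at this
  rw [neg_smul]
  convert eq_neg_of_add_eq_zero_left this.symm

open scoped Classical in
/-- A wall is contained in exactly two full-dimensional cones. -/
theorem eq_or_eq {σ : Finset ι} {i κ : ι} (h : X.IsWall σ i κ) {τ : Finset ι}
    (hτ : τ ∈ X.maxCones) (hsub : σ.erase i ⊆ τ) : τ = σ ∨ τ = insert κ (σ.erase i) := by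
  have hcard : τ.card = (σ.erase i).card + 1 := by
    rw [Finset.card_erase_add_one h.2.1, h.1.2, hτ.2]
  obtain ⟨j, hj, rfl⟩ := (Finset.exists_eq_insert_iff.2 ⟨hsub, hcard.symm⟩)
  have hσ : insert i (σ.erase i) = σ := Finset.insert_erase h.2.1
  rcases lt_trichotomy (X.coord σ i (X.vec j)) 0 with hlt | heq | hgt
  · right
    rw [eq_of_same_side (fun h' => h.2.2.1 (Finset.mem_of_mem_erase h')) hj h.2.2.2.1 hτ
      (h.coord_pos hlt)]
  -- If `u_j` had `i`-coordinate zero, `coord σ i` would vanish on a basis, although it is negative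
  -- on `u_κ`.
  · exfalso
    have h1 : ∀ μ, X.coord σ i (X.vec μ) ≠ 0 → μ ∉ insert j (σ.erase i) := by
      intro μ h0 hμ
      rcases Finset.mem_insert.1 hμ with rfl | hμ
      · exact h0 heq
      · exact h0 (by rw [coord_vec h.1.1 i (Finset.mem_of_mem_erase hμ),
          if_neg (Finset.ne_of_mem_erase hμ)])
    have h2 : X.coord σ i = 0 := linearMap_ext hτ fun μ hμ => by
      by_contra h0
      exact h1 μ h0 hμ
    have h3 := h.2.2.2.2
    rw [h2] at h3
    simp at h3
  · left
    have := eq_of_same_side (Finset.notMem_erase i σ) hj (by rw [hσ]; exact h.1) hτ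
      (by rw [hσ]; exact hgt)
    rw [this, hσ]

end IsWall

/-- Every relation `rel σ ρ` is a nonnegative combination of wall relations. -/
theorem rel_mem_span (hX : X.IsComplete) {D : ι → ℤ} (hD : X.IsAmple D) {σ : Finset ι}
    (hσ : σ ∈ X.maxCones) (ρ : ι) :
    X.rel σ ρ ∈ Submodule.span ℝ≥0 {r | ∃ σ i κ, X.IsWall σ i κ ∧ r = X.rel σ κ} := by
  classical
  by_contra hbad
  let S : Set (Finset ι × ι) := {p | p.1 ∈ X.maxCones ∧
    X.rel p.1 p.2 ∉ Submodule.span ℝ≥0 {r | ∃ σ i κ, X.IsWall σ i κ ∧ r = X.rel σ κ}}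
  -- Among the finitely many counterexamples, one of least `D`-degree.
  obtain ⟨⟨σ, ρ⟩, ⟨hσ, hmem⟩, hmin⟩ := Set.exists_min_image S
    (fun p => ∑ κ, (D κ : ℝ) * X.rel p.1 p.2 κ) (Set.toFinite S) ⟨(σ, ρ), hσ, hbad⟩
  dsimp only at hσ hmem hmin
  have hρ : ρ ∉ σ := by
    intro h
    rw [rel_eq_zero hσ.1 h] at hmem
    exact hmem (Submodule.zero_mem _)
  obtain ⟨i, hi⟩ : ∃ i, X.coord σ i (X.vec ρ) < 0 := by
    by_contra! h
    refine hρ (mem_of_coeff_ne_zero (c := fun κ => if κ = ρ then 1 else 0) (σ := {ρ})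
      (X.singleton_mem ρ) hσ.1 (fun κ => by split_ifs <;> norm_num) (fun κ hκ => ?_) ?_
      (ρ := ρ) (by simp))
    · simpa using hκ
    · simpa using (mem_cone_iff hσ).2 h
  have hiσ : i ∈ σ := by
    by_contra h
    rw [coord_eq_zero hσ h] at hi
    simp at hi
  -- Crossing the facet that separates `σ` from `u_ρ` leaves another counterexample, whose degree is
  -- smaller by `b` times the positive degree of the wall relation.
  obtain ⟨κ, hκ, hτ, hneg⟩ := hX.exists_adjacent hσ hiσ
  have hwall : X.IsWall σ i κ := ⟨hσ, hiσ, hκ, hτ, hneg⟩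
  have hb := hwall.coord_pos hi
  have heq := hwall.rel_eq ρ
  set τ := insert κ (σ.erase i)
  set b := X.coord τ κ (X.vec ρ)
  have h1 : X.rel τ ρ ∉
      Submodule.span ℝ≥0 {r | ∃ σ i κ, X.IsWall σ i κ ∧ r = X.rel σ κ} := by
    intro h
    refine hmem ?_
    rw [heq]
    exact Submodule.add_mem _ h (Submodule.smul_mem _ (⟨b, hb.le⟩ : ℝ≥0)
      (Submodule.subset_span ⟨σ, i, κ, hwall, rfl⟩))
  have h2 := hmin (τ, ρ) ⟨hτ, h1⟩
  dsimp only at h2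
  have h3 := hD.sum_mul_rel_pos hσ hκ
  have h4 : ∑ μ, (D μ : ℝ) * X.rel σ ρ μ =
      ∑ μ, (D μ : ℝ) * X.rel τ ρ μ + b * ∑ μ, (D μ : ℝ) * X.rel σ κ μ := by
    rw [heq, Finset.mul_sum, ← Finset.sum_add_distrib]
    refine Finset.sum_congr rfl fun μ _ => ?_
    simp only [Pi.add_apply, Pi.smul_apply, smul_eq_mul]
    ring
  have h5 := mul_pos hb h3
  linarith

end SimplicialFan

/-! ### Curves: location of places and numerical classes -/

namespace SimplicialFan

open Filter

variable {n : ℕ} {ι : Type*} [Fintype ι] {X : SimplicialFan n ι}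

theorem mem_perp {γ : Finset ι} {m : Fin n → ℤ} : m ∈ X.perp γ ↔ ∀ ρ ∈ γ, m ⬝ᵥ X.u ρ = 0 := Iff.rfl

/-- The sublattice `γ^⊥ ∩ M` is a direct summand of `M`. -/
theorem exists_retraction_perp (X : SimplicialFan n ι) (γ : Finset ι) :
    ∃ π : (Fin n → ℤ) →+ X.perp γ, ∀ m : X.perp γ, π m = m := by
  let f : (Fin n → ℤ) →ₗ[ℤ] ((ρ : {ρ // ρ ∈ γ}) → ℤ) :=
    LinearMap.pi fun ρ => (dotProductBilin ℤ ℤ).flip (X.u ρ)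
  have hf : ∀ m, f m = 0 ↔ m ∈ X.perp γ := by
    intro m
    rw [funext_iff, mem_perp, Subtype.forall]
    rfl
  -- The image of `f` is a subgroup of a finite free `ℤ`-module, hence free, so `f` splits over it.
  obtain ⟨g, hg⟩ := f.rangeRestrict.exists_rightInverse_of_surjective f.range_rangeRestrict
  have hg' : ∀ m, f (g (f.rangeRestrict m)) = f m := fun m =>
    congrArg Subtype.val (LinearMap.congr_fun hg (f.rangeRestrict m))
  refine ⟨AddMonoidHom.codRestrict (LinearMap.id - g ∘ₗ f.rangeRestrict).toAddMonoidHom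
    (X.perp γ) fun m => ?_, fun m => ?_⟩
  · rw [← hf]
    simp [hg']
  · have h0 : f.rangeRestrict m = 0 := Subtype.ext ((hf m).2 m.2)
    refine Subtype.ext ?_
    simp [h0]

instance perp_fg (γ : Finset ι) : AddMonoid.FG (X.perp γ) := by
  obtain ⟨π, hπ⟩ := X.exists_retraction_perp γ
  have : AddMonoid.FG (Fin n → ℤ) := inferInstance
  exact AddMonoid.fg_of_surjective π fun m => ⟨m, hπ m⟩

/-- A covector of `M_ℚ` has an integral multiple. -/
theorem exists_nat_mul_eq_intCast (m : Fin n → ℚ) :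
    ∃ N : ℕ, 0 < N ∧ ∃ m' : Fin n → ℤ, ∀ i, (m' i : ℚ) = N * m i := by
  refine ⟨∏ i, (m i).den, Finset.prod_pos fun i _ => (m i).den_pos,
    fun i => (∏ j ∈ Finset.univ.erase i, (m j).den : ℕ) * (m i).num, fun i => ?_⟩
  rw [← Finset.mul_prod_erase _ _ (Finset.mem_univ i)]
  push_cast
  have := Rat.den_mul_eq_num (m i)
  rw [← this]
  ring

namespace Curve

variable {K : Type*} [Field K] (C : X.Curve K)

instance : Algebra.EssFiniteType K C.FunctionField :=
  have := AddMonoidAlgebra.finiteType_of_fg K (X.perp C.orbit)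
  Algebra.EssFiniteType.comp K (X.OrbitRing K C.orbit) _

theorem char_zero : C.char 0 = 1 := by
  rw [char, ← AddMonoidAlgebra.one_def, map_one]

theorem char_add (a b : X.perp C.orbit) : C.char (a + b) = C.char a * C.char b := by
  rw [char, char, char, ← map_mul, AddMonoidAlgebra.single_mul_single, one_mul]

theorem char_ne_zero (a : X.perp C.orbit) : C.char a ≠ 0 := by
  intro h
  have := C.char_add a (-a)
  rw [add_neg_cancel, char_zero, h, zero_mul] at this
  exact one_ne_zero this

/-- The homomorphism `m ↦ ord_v (χ^m)`. -/
def ordHom (v : Place K C.FunctionField) : X.perp C.orbit →+ ℤ where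
  toFun m := v.ord (C.char m)
  map_zero' := by rw [char_zero, Place.ord_one]
  map_add' a b := by rw [char_add, v.ord_mul (C.char_ne_zero a) (C.char_ne_zero b)]

/-- Finitely many characters generate the lattice, and each has finitely many zeros and poles.
Without this finiteness the `finsum` in `inter` could take its default value 0. -/
theorem finite_setOf_ordHom_ne_zero : {v | C.ordHom v ≠ 0}.Finite := by
  obtain ⟨π, hπ⟩ := X.exists_retraction_perp C.orbit
  refine (Set.finite_iUnion fun i : Fin n => Place.finite_setOf_ord_ne_zero (K := K)
    C.trdeg_eq_one (C.char_ne_zero (π (Pi.single i 1)))).subset fun v hv => ?_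
  by_contra h
  simp only [Set.mem_iUnion, Set.mem_ofPred_eq, not_exists, not_not] at h
  refine hv ?_
  have h1 : (C.ordHom v).comp π = 0 := by
    refine AddMonoidHom.functions_ext _ _ _ fun i x => ?_
    have : (Pi.single i x : Fin n → ℤ) = x • Pi.single i 1 := by
      rw [← Pi.single_smul, smul_eq_mul, mul_one]
    rw [this, map_zsmul]
    exact (congrArg (x • ·) (h i)).trans (smul_zero x)
  refine AddMonoidHom.ext fun m => ?_
  rw [← hπ m]
  exact DFunLike.congr_fun h1 (m : Fin n → ℤ)

theorem exists_ordHom_eq (v : Place K C.FunctionField) :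
    ∃ w : Fin n → ℤ, ∀ m : X.perp C.orbit, C.ordHom v m = (m : Fin n → ℤ) ⬝ᵥ w := by
  obtain ⟨π, hπ⟩ := X.exists_retraction_perp C.orbit
  refine ⟨fun i => C.ordHom v (π (Pi.single i 1)), fun m => ?_⟩
  let g : (Fin n → ℤ) →ₗ[ℤ] ℤ := ((C.ordHom v).comp π).toIntLinearMap
  have h1 : C.ordHom v m = g m := by
    simp [g, hπ]
  rw [h1, LinearMap.pi_apply_eq_sum_univ g]
  refine Finset.sum_congr rfl fun i _ => ?_
  rw [smul_eq_mul]
  congr 1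
  refine congrArg g (funext fun j => ?_)
  simp [Pi.single_apply, eq_comm]

/-- Adding multiples of the generators of `γ` to `w` does not change its pairing with `γ^⊥`. The
points `p + w/(k+1)` tend to an interior point of `γ`, so a cone containing infinitely many of them
has `γ` as a face; rescaling one of them by `k + 1` gives the integral vector. -/
theorem exists_isLocation (hX : X.IsComplete) (v : Place K C.FunctionField) :
    ∃ p, C.IsLocation v p := by
  obtain ⟨w, hw⟩ := C.exists_ordHom_eq v
  let p : Fin n → ℝ := ∑ ρ ∈ C.orbit, X.vec ρ
  obtain ⟨σ, hσ, hf⟩ := hX.exists_frequently_mem_maxCone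
    fun k => p + (1 / ((k : ℝ) + 1)) • fun i => (w i : ℝ)
  have hlim : Tendsto (fun k : ℕ => p + (1 / ((k : ℝ) + 1)) • fun i => (w i : ℝ)) atTop
      (𝓝 (p + (0 : ℝ) • fun i => (w i : ℝ))) :=
    (tendsto_one_div_add_atTop_nhds_zero_nat.smul_const _).const_add p
  rw [zero_smul, add_zero] at hlim
  have hsub : C.orbit ⊆ σ := subset_of_sum_mem C.orbit_mem hσ.1 (subset_refl _)
    ((isClosed_cone hσ).mem_of_frequently_of_tendsto hf hlim)
  obtain ⟨k, hk⟩ := hf.exists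
  refine ⟨(σ, fun i => (k + 1) * ∑ ρ ∈ C.orbit, X.u ρ i + w i), hσ, hsub, fun m => ?_, ?_⟩
  · refine (hw m).trans ?_
    have h1 : (fun i => ((k : ℤ) + 1) * ∑ ρ ∈ C.orbit, X.u ρ i + w i) =
        ((k : ℤ) + 1) • ∑ ρ ∈ C.orbit, X.u ρ + w := by
      funext i
      simp [Finset.sum_apply]
    dsimp only
    rw [h1, dotProduct_add, dotProduct_smul, dotProduct_sum,
      Finset.sum_eq_zero fun ρ hρ => m.2 ρ hρ, smul_zero, zero_add]
  · rw [mem_cone_iff hσ] at hk ⊢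
    have h1 : (fun i => (((k + 1) * ∑ ρ ∈ C.orbit, X.u ρ i + w i : ℤ) : ℝ)) =
        ((k : ℝ) + 1) • (p + (1 / ((k : ℝ) + 1)) • fun i => (w i : ℝ)) := by
      funext i
      have : (k : ℝ) + 1 ≠ 0 := by positivity
      simp [p, Finset.sum_apply, vec]
      field_simp
    intro ρ
    dsimp only
    rw [h1, map_smul]
    exact mul_nonneg (by positivity) (hk ρ)

theorem isLocation_location (hX : X.IsComplete) (v : Place K C.FunctionField) :
    C.IsLocation v (C.location v) :=
  Classical.epsilon_spec (C.exists_isLocation hX v)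

theorem chart_mem (hX : X.IsComplete) : C.chart ∈ X.maxCones ∧ C.orbit ⊆ C.chart := by
  obtain ⟨σ, hσ, h⟩ := hX.exists_maxCone C.orbit_mem
  exact Classical.epsilon_spec (p := fun σ => σ ∈ X.maxCones ∧ C.orbit ⊆ σ) ⟨σ, hσ, h⟩

theorem localOrd_eq_sum (hX : X.IsComplete) (v : Place K C.FunctionField) (D : ι → ℤ) :
    C.localOrd D v = ∑ ρ, (D ρ : ℚ) * C.localOrd (rayDivisor ρ) v := by
  rw [localOrd, cartierDatum_eq_sum (C.chart_mem hX).1, cartierDatum_eq_sum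
    (C.isLocation_location hX v).1, ← Finset.sum_sub_distrib, sum_dotProduct]
  refine Finset.sum_congr rfl fun ρ _ => ?_
  rw [← smul_sub, smul_dotProduct, smul_eq_mul, localOrd]

/-- The coefficients are the coordinates of `w` in the cone of its own location, hence nonnegative;
this makes curve classes nonnegative combinations of relations. -/
theorem localOrd_rayDivisor (hX : X.IsComplete) (v : Place K C.FunctionField) (κ : ι) :
    (C.localOrd (rayDivisor κ) v : ℝ) =
      ∑ ρ, X.coord (C.location v).1 ρ (fun i => ((C.location v).2 i : ℝ)) *
        X.rel C.chart ρ κ := by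
  rw [← coord_sub_coord (C.isLocation_location hX v).1, localOrd, sub_dotProduct, Rat.cast_sub,
    ← pairing_intCast, ← pairing_intCast, coord, coord]
  simp only [LinearMap.neg_apply]
  ring

/-- A place at which all characters are units does not contribute to intersection numbers. -/
theorem localOrd_eq_zero (hX : X.IsComplete) {v : Place K C.FunctionField}
    (hv : C.ordHom v = 0) (D : ι → ℤ) : C.localOrd D v = 0 := by
  have hloc := C.isLocation_location hX v
  set m := X.cartierDatum D C.chart - X.cartierDatum D (C.location v).1 with hm
  -- The two Cartier data agree on the rays of the orbit cone, so a positive integral multiple of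
  -- `m` is a character of the orbit, and its order at `v` is zero.
  obtain ⟨N, hN, m', hm'⟩ := exists_nat_mul_eq_intCast m
  have hcast : ∀ w : Fin n → ℤ, ((m' ⬝ᵥ w : ℤ) : ℚ) = N * (m ⬝ᵥ fun i => (w i : ℚ)) := by
    intro w
    simp [dotProduct, hm', Finset.mul_sum, mul_assoc]
  have hperp : m' ∈ X.perp C.orbit := by
    intro ρ hρ
    have h1 := cartierDatum_spec (C.chart_mem hX).1.1 D ρ ((C.chart_mem hX).2 hρ)
    have h2 := cartierDatum_spec hloc.1.1 D ρ (hloc.2.1 hρ)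
    have h3 := hcast (X.u ρ)
    rw [hm, sub_dotProduct, h1, h2, sub_self, mul_zero] at h3
    exact_mod_cast h3
  have h1 := hloc.2.2.1 ⟨m', hperp⟩
  have h2 : v.ord (C.char ⟨m', hperp⟩) = 0 := DFunLike.congr_fun hv _
  have h3 := hcast (C.location v).2
  rw [← h1, h2, Int.cast_zero, zero_eq_mul] at h3
  exact h3.resolve_left (by exact_mod_cast hN.ne')

/-- The finite set of places with a nontrivial contribution to intersection numbers. -/
def boundary : Finset (Place K C.FunctionField) := C.finite_setOf_ordHom_ne_zero.toFinset

theorem inter_eq_sum_boundary (hX : X.IsComplete) (D : ι → ℤ) :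
    C.inter D = ∑ v ∈ C.boundary, (v.deg : ℚ) * C.localOrd D v := by
  refine finsum_eq_sum_of_support_subset _ fun v hv => ?_
  rw [boundary, Set.Finite.coe_toFinset]
  intro h
  exact hv (by simp [C.localOrd_eq_zero hX h])

theorem inter_eq_sum (hX : X.IsComplete) (D : ι → ℤ) :
    C.inter D = ∑ ρ, (D ρ : ℚ) * C.inter (rayDivisor ρ) := by
  simp only [C.inter_eq_sum_boundary hX, Finset.mul_sum]
  rw [Finset.sum_comm]
  refine Finset.sum_congr rfl fun v _ => ?_
  rw [C.localOrd_eq_sum hX, Finset.mul_sum]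
  refine Finset.sum_congr rfl fun ρ _ => ?_
  ring

/-- The numerical class of a curve. -/
def numClass : ι → ℝ := fun ρ => (C.inter (rayDivisor ρ) : ℝ)

theorem numClass_eq_sum (hX : X.IsComplete) :
    C.numClass = ∑ v ∈ C.boundary, ∑ ρ, ((v.deg : ℝ) *
      X.coord (C.location v).1 ρ (fun i => ((C.location v).2 i : ℝ))) • X.rel C.chart ρ := by
  funext κ
  rw [numClass, C.inter_eq_sum_boundary hX]
  push_cast
  simp only [C.localOrd_rayDivisor hX, Finset.sum_apply, Pi.smul_apply, smul_eq_mul,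
    Finset.mul_sum, mul_assoc]

/-- The class of a curve is a nonnegative combination of wall relations. -/
theorem numClass_mem_span (hX : X.IsComplete) {D : ι → ℤ} (hD : X.IsAmple D) :
    C.numClass ∈ Submodule.span ℝ≥0 {r | ∃ σ i κ, X.IsWall σ i κ ∧ r = X.rel σ κ} := by
  rw [C.numClass_eq_sum hX]
  refine Submodule.sum_mem _ fun v _ => Submodule.sum_mem _ fun ρ _ => ?_
  have hloc := C.isLocation_location hX v
  exact Submodule.smul_mem _ (⟨_, mul_nonneg (Nat.cast_nonneg _)
    ((mem_cone_iff hloc.1).1 hloc.2.2.2 ρ)⟩ : ℝ≥0) (rel_mem_span hX hD (C.chart_mem hX).1 ρ)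

end Curve

namespace OneCycle

variable {K : Type*} [Field K]

theorem inter_eq_sum (hX : X.IsComplete) (C : X.OneCycle K) (D : ι → ℤ) :
    C.inter D = ∑ ρ, (D ρ : ℚ) * C.inter (rayDivisor ρ) := by
  simp only [inter, Finsupp.sum, Finset.mul_sum]
  rw [Finset.sum_comm]
  refine Finset.sum_congr rfl fun Z _ => ?_
  rw [Z.inter_eq_sum hX, Finset.mul_sum]
  refine Finset.sum_congr rfl fun ρ _ => ?_
  ring

theorem numClass_eq_sum (C : X.OneCycle K) :
    C.numClass = C.sum fun Z k => (k : ℝ) • Z.numClass := by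
  funext ρ
  simp [numClass, inter, Finsupp.sum, Curve.numClass]

theorem numClass_single (Z : X.Curve K) :
    numClass (Finsupp.single Z 1 : X.OneCycle K) = Z.numClass := by
  rw [numClass_eq_sum, Finsupp.sum_single_index] <;> simp

end OneCycle

end SimplicialFan

/-! ### The rational function field and its place at infinity -/

section RatFunc

variable (K : Type*) [Field K]

theorem trdeg_ratFunc : Algebra.trdeg K (RatFunc K) = 1 := by
  have h := trdeg_add_eq K (Polynomial K) (A := RatFunc K)
  have : Algebra.IsAlgebraic (Polynomial K) (RatFunc K) :=
    IsLocalization.isAlgebraic _ (nonZeroDivisors (Polynomial K))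
  rw [Polynomial.trdeg_of_isDomain, trdeg_eq_zero, add_zero] at h
  exact h.symm

open scoped Classical in
/-- The residue field of `K(t)` at infinity is `K`. -/
theorem exists_inftyValuation_sub_lt_one {f : RatFunc K} (hf : RatFunc.inftyValuation K f ≤ 1) :
    ∃ c : K, RatFunc.inftyValuation K (f - RatFunc.C c) < 1 := by
  rcases hf.lt_or_eq with h | h
  · exact ⟨0, by simpa using h⟩
  obtain ⟨p, q, hq, rfl⟩ := IsFractionRing.div_surjective (A := Polynomial K) f
  have hq0 : q ≠ 0 := nonZeroDivisors.ne_zero hq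
  have hp0 : p ≠ 0 := by
    rintro rfl
    simp at h
  have hpoly : ∀ {p : Polynomial K}, p ≠ 0 → RatFunc.inftyValuation K
      (algebraMap (Polynomial K) (RatFunc K) p) = WithZero.exp (p.natDegree : ℤ) :=
    RatFunc.inftyValuation.polynomial K
  rw [map_div₀, hpoly hp0, hpoly hq0, div_eq_one_iff_eq WithZero.exp_ne_zero, WithZero.exp_inj,
    Nat.cast_inj] at h
  have hl : q.leadingCoeff ≠ 0 := Polynomial.leadingCoeff_ne_zero.2 hq0
  have hlp : p.leadingCoeff ≠ 0 := Polynomial.leadingCoeff_ne_zero.2 hp0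
  -- Numerator and denominator have equal degree; subtracting this constant cancels the leading
  -- term.
  set c := p.leadingCoeff / q.leadingCoeff with hc
  have hc0 : c ≠ 0 := div_ne_zero hlp hl
  refine ⟨c, ?_⟩
  have hqF : algebraMap (Polynomial K) (RatFunc K) q ≠ 0 := RatFunc.algebraMap_ne_zero hq0
  have heq : algebraMap (Polynomial K) (RatFunc K) p / algebraMap _ _ q - RatFunc.C c =
      algebraMap _ _ (p - Polynomial.C c * q) / algebraMap _ _ q := by
    rw [map_sub, map_mul, RatFunc.algebraMap_C, sub_div, mul_div_cancel_right₀ _ hqF]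
  rw [heq, map_div₀]
  by_cases hr : p - Polynomial.C c * q = 0
  · simp [hr]
  have hdeg : (p - Polynomial.C c * q).natDegree < q.natDegree := by
    rw [← h]
    refine Polynomial.natDegree_lt_natDegree hr (Polynomial.degree_sub_lt_left ?_ hp0 ?_)
    · rw [Polynomial.degree_C_mul hc0, Polynomial.degree_eq_natDegree hp0,
        Polynomial.degree_eq_natDegree hq0, h]
    · rw [Polynomial.leadingCoeff_mul, Polynomial.leadingCoeff_C, hc, div_mul_cancel₀ _ hl]
  rw [hpoly hr, hpoly hq0,
    ← WithZero.exp_sub, ← WithZero.exp_zero, WithZero.exp_lt_exp]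
  omega

/-- The hypothesis says that constants exhaust the residue field. -/
theorem Place.deg_eq_one {K F : Type*} [Field K] [Field F] [Algebra K F] (v : Place K F)
    (h : ∀ f, v.val f ≤ 1 → ∃ c : K, v.val (f - algebraMap K F c) < 1) : v.deg = 1 := by
  have hsurj : Function.Surjective v.toResidueField := by
    intro r
    obtain ⟨f, rfl⟩ := IsLocalRing.residue_surjective r
    obtain ⟨c, hc⟩ := h f ((Valuation.mem_valuationSubring_iff _ _).1 f.2)
    refine ⟨c, ?_⟩
    rw [toResidueField, RingHom.comp_apply, ← sub_eq_zero, ← map_sub,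
      IsLocalRing.residue_eq_zero_iff]
    rw [← neg_sub, neg_mem_iff]
    exact (Valuation.mem_maximalIdeal_iff _ _).2 hc
  let _ := v.toResidueField.toAlgebra
  exact finrank_eq_one 1 one_ne_zero fun w => by
    obtain ⟨c, hc⟩ := hsurj w
    exact ⟨c, by rw [Algebra.smul_def, mul_one]; exact hc⟩

open scoped Classical in
/-- The pole of `t` in a field isomorphic to `K(t)`. -/
theorem exists_place_ord_eq_neg_one {F : Type*} [Field F] [Algebra K F] (e : F ≃ₐ[K] RatFunc K) :
    ∃ v : Place K F, v.deg = 1 ∧ ∀ f, e f = RatFunc.X → v.ord f = -1 := by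
  let v : Place K F :=
    { val := (RatFunc.inftyValuation K).comap (e : F →+* RatFunc K)
      surjective := by
        intro y
        rcases eq_or_ne y 0 with rfl | hy
        · exact ⟨0, map_zero _⟩
        · refine ⟨e.symm (RatFunc.X ^ y.log), ?_⟩
          rw [Valuation.comap_apply, RingHom.coe_coe, e.apply_symm_apply,
            RatFunc.inftyValuation.X_zpow, WithZero.exp_log hy]
      trivial := by
        intro c hc
        rw [Valuation.comap_apply, RingHom.coe_coe, e.commutes, RatFunc.algebraMap_eq_C]
        exact RatFunc.inftyValuation.C K hc }
  refine ⟨v, v.deg_eq_one fun f hf => ?_, fun f hf => ?_⟩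
  · obtain ⟨c, hc⟩ := exists_inftyValuation_sub_lt_one K (f := e f) hf
    refine ⟨c, ?_⟩
    rw [Valuation.comap_apply, RingHom.coe_coe, map_sub, e.commutes, RatFunc.algebraMap_eq_C]
    exact hc
  · rw [Place.ord, Valuation.comap_apply, RingHom.coe_coe, hf, RatFunc.inftyValuation.X,
      WithZero.log_exp]

end RatFunc

/-! ### One-dimensional tori -/

section GroupAlgebra

variable (K : Type*) [Field K] {G : Type*} [AddCommGroup G]

/-- The group algebra of an infinite cyclic group is the ring of Laurent polynomials. -/
theorem exists_algEquiv_laurentPolynomial {g : G} (hgen : ∀ m, ∃ k : ℤ, m = k • g)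
    (hg : ∀ k : ℤ, k • g = 0 → k = 0) :
    ∃ ψ : LaurentPolynomial K ≃ₐ[K] AddMonoidAlgebra K G,
      ψ (LaurentPolynomial.T 1) = AddMonoidAlgebra.single g 1 := by
  let φ : ℤ ≃+ G := AddEquiv.ofBijective (zmultiplesHom G g)
    ⟨(injective_iff_map_eq_zero _).2 hg, fun m => (hgen m).imp fun k hk => hk.symm⟩
  refine ⟨AddMonoidAlgebra.domCongr K K φ, ?_⟩
  rw [LaurentPolynomial.T, AddMonoidAlgebra.domCongr_single]
  exact congrArg (AddMonoidAlgebra.single · 1) (one_zsmul g)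

theorem exists_algEquiv_ratFunc {g : G} (hgen : ∀ m, ∃ k : ℤ, m = k • g)
    (hg : ∀ k : ℤ, k • g = 0 → k = 0) (F : Type*) [Field F] [Algebra (AddMonoidAlgebra K G) F]
    [IsFractionRing (AddMonoidAlgebra K G) F] [Algebra K F]
    [IsScalarTower K (AddMonoidAlgebra K G) F] :
    ∃ e : F ≃ₐ[K] RatFunc K,
      e (algebraMap (AddMonoidAlgebra K G) F (AddMonoidAlgebra.single g 1)) = RatFunc.X := by
  obtain ⟨ψ, hψ⟩ := exists_algEquiv_laurentPolynomial K hgen hg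
  let θ : LaurentPolynomial K →ₐ[K] F :=
    (IsScalarTower.toAlgHom K (AddMonoidAlgebra K G) F).comp ψ.toAlgHom
  have hθ : Function.Injective θ :=
    (IsFractionRing.injective (AddMonoidAlgebra K G) F).comp ψ.injective
  let _ : Algebra (Polynomial K) F := (θ.comp Polynomial.toLaurentAlg).toRingHom.toAlgebra
  have hmap : ∀ p : Polynomial K, algebraMap (Polynomial K) F p = θ (Polynomial.toLaurent p) :=
    fun _ => rfl
  have : IsScalarTower K (Polynomial K) F := IsScalarTower.of_algebraMap_eq fun c => by
    rw [hmap, Polynomial.algebraMap_eq, Polynomial.toLaurent_C, ← θ.commutes]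
    rfl
  have : FaithfulSMul (Polynomial K) F := (faithfulSMul_iff_algebraMap_injective _ _).2
    (hθ.comp Polynomial.toLaurent_injective)
  have : IsFractionRing (Polynomial K) F := by
    refine IsFractionRing.of_field _ _ fun z => ?_
    obtain ⟨a, b, hb, rfl⟩ := IsFractionRing.div_surjective (A := AddMonoidAlgebra K G) z
    obtain ⟨a, rfl⟩ := ψ.surjective a
    obtain ⟨b, rfl⟩ := ψ.surjective b
    obtain ⟨k, p, hp⟩ := a.exists_T_pow
    obtain ⟨l, q, hq⟩ := b.exists_T_pow
    -- The powers are crossed: `p` already carries the factor `T k` and `q` the factor `T l`, so the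
    -- quotient is unchanged.
    refine ⟨p * Polynomial.X ^ l, q * Polynomial.X ^ k, ?_⟩
    have hT : ∀ j : ℤ, θ (LaurentPolynomial.T j) ≠ 0 := fun j =>
      (LaurentPolynomial.isUnit_T j).map θ |>.ne_zero
    change θ a / θ b = _
    simp only [hmap, map_mul, hp, hq, Polynomial.toLaurent_X_pow]
    rw [mul_assoc, mul_assoc,
      mul_comm (θ (LaurentPolynomial.T l)), mul_div_mul_right _ _ (mul_ne_zero (hT _) (hT _))]
  let e := IsLocalization.algEquiv (nonZeroDivisors (Polynomial K)) F (RatFunc K)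
  refine ⟨e.restrictScalars K, ?_⟩
  have : algebraMap (AddMonoidAlgebra K G) F (AddMonoidAlgebra.single g 1) =
      algebraMap (Polynomial K) F Polynomial.X := by
    rw [hmap, Polynomial.toLaurent_X, ← hψ]
    rfl
  rw [this, AlgEquiv.restrictScalars_apply, e.commutes, RatFunc.algebraMap_X]

end GroupAlgebra

/-! ### Curves of walls -/

namespace SimplicialFan

variable {n : ℕ} {ι : Type*} [Fintype ι] {X : SimplicialFan n ι} (K : Type*) [Field K]

/-- The closure of a one-dimensional torus orbit is a curve. -/
theorem exists_curve {γ : Finset ι} (hγ : γ ∈ X.cones) {g : X.perp γ}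
    (hgen : ∀ m, ∃ k : ℤ, m = k • g) (hg : g ≠ 0) :
    ∃ Z : X.Curve K, Z.orbit = γ ∧ Z.ideal = ⊥ := by
  have hg' : ∀ k : ℤ, k • g = 0 → k = 0 := fun k hk => (smul_eq_zero.1 hk).resolve_right hg
  obtain ⟨ψ, -⟩ := exists_algEquiv_laurentPolynomial K hgen hg'
  have : IsDomain (X.OrbitRing K γ) := ψ.symm.toMulEquiv.isDomain _
  obtain ⟨e, -⟩ := exists_algEquiv_ratFunc K hgen hg' (⊥ : Ideal (X.OrbitRing K γ)).ResidueField
  refine ⟨⟨γ, hγ, ⊥, Ideal.isPrime_bot, ?_⟩, rfl, rfl⟩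
  have := e.lift_trdeg_eq
  rwa [trdeg_ratFunc, Cardinal.lift_one, Cardinal.lift_eq_one] at this

variable {K}

/-- The function field is `K(t)` with `t` the generating character, and the place is `t = ∞`. It
makes the class of a wall curve nonzero. -/
theorem Curve.exists_place (Z : X.Curve K) (hZ : Z.ideal = ⊥) {g : X.perp Z.orbit}
    (hgen : ∀ m, ∃ k : ℤ, m = k • g) (hg : g ≠ 0) :
    ∃ v : Place K Z.FunctionField, v.deg = 1 ∧ v.ord (Z.char g) = -1 := by
  have hg' : ∀ k : ℤ, k • g = 0 → k = 0 := fun k hk => (smul_eq_zero.1 hk).resolve_right hg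
  obtain ⟨γ, hγ, I, hI, ht⟩ := Z
  obtain rfl : I = ⊥ := hZ
  obtain ⟨ψ, -⟩ := exists_algEquiv_laurentPolynomial K hgen hg'
  have : IsDomain (X.OrbitRing K γ) := ψ.symm.toMulEquiv.isDomain _
  obtain ⟨e, he⟩ := exists_algEquiv_ratFunc K hgen hg' (⊥ : Ideal (X.OrbitRing K γ)).ResidueField
  obtain ⟨v, hv, hv'⟩ := exists_place_ord_eq_neg_one K e
  exact ⟨v, hv, hv' _ he⟩

open scoped Classical in
/-- The lattice `τ^⊥ ∩ M` of a facet `τ` of a full-dimensional cone is infinite cyclic. -/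
theorem exists_generator_perp {σ : Finset ι} (hσ : σ ∈ X.maxCones) {i : ι} (hi : i ∈ σ) :
    ∃ g : X.perp (σ.erase i), (∀ m, ∃ k : ℤ, m = k • g) ∧ 0 < (g : Fin n → ℤ) ⬝ᵥ X.u i := by
  let f : X.perp (σ.erase i) →+ ℤ :=
    { toFun := fun m => (m : Fin n → ℤ) ⬝ᵥ X.u i
      map_zero' := zero_dotProduct _
      map_add' := fun a b => add_dotProduct _ _ _ }
  have hcast : ∀ (m : Fin n → ℤ) (ρ : ι), pairing (fun i => (m i : ℚ)) (X.vec ρ) =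
      ((m ⬝ᵥ X.u ρ : ℤ) : ℝ) := by
    intro m ρ
    simp [pairing_apply, vec, dotProduct]
  have hinj : Function.Injective f := by
    refine (injective_iff_map_eq_zero f).2 fun m hm => ?_
    have h1 : pairing (fun i => ((m : Fin n → ℤ) i : ℚ)) = pairing 0 := by
      refine linearMap_ext hσ fun ρ hρ => ?_
      rw [hcast]
      by_cases h : ρ = i
      · subst h
        have : (m : Fin n → ℤ) ⬝ᵥ X.u ρ = 0 := hm
        simp [this, pairing_apply]
      · simp [mem_perp.1 m.2 ρ (Finset.mem_erase.2 ⟨h, hρ⟩), pairing_apply]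
    have h2 := pairing_injective h1
    refine Subtype.ext (funext fun j => ?_)
    have := congrFun h2 j
    simpa using this
  -- A multiple of the dual basis covector at `i` is integral. So `f` embeds the lattice as a
  -- nonzero subgroup of `ℤ`.
  have hne : ∃ m, f m ≠ 0 := by
    obtain ⟨N, hN, m', hm'⟩ := exists_nat_mul_eq_intCast (X.cartierDatum (rayDivisor i) σ)
    have h1 : ∀ ρ ∈ σ, ((m' ⬝ᵥ X.u ρ : ℤ) : ℚ) = N * -(rayDivisor i ρ : ℚ) := by
      intro ρ hρ
      rw [← cartierDatum_spec hσ.1 _ ρ hρ]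
      simp [dotProduct, hm', Finset.mul_sum, mul_assoc]
    refine ⟨⟨m', fun ρ hρ => ?_⟩, fun h0 => ?_⟩
    · have := h1 ρ (Finset.mem_of_mem_erase hρ)
      rw [rayDivisor, Pi.single_eq_of_ne (Finset.ne_of_mem_erase hρ)] at this
      simpa using this
    · have h2 : m' ⬝ᵥ X.u i = 0 := h0
      have := h1 i hi
      rw [h2, rayDivisor, Pi.single_eq_same] at this
      simp at this
      omega
  obtain ⟨a, ha⟩ := Int.subgroup_cyclic f.range
  have hmem : a ∈ f.range := by
    rw [ha]
    exact AddSubgroup.subset_closure rfl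
  obtain ⟨g, rfl⟩ := hmem
  have hgen : ∀ m, ∃ k : ℤ, m = k • g := by
    intro m
    have : f m ∈ AddSubgroup.closure {f g} := ha ▸ ⟨m, rfl⟩
    obtain ⟨k, hk⟩ := AddSubgroup.mem_closure_singleton.1 this
    exact ⟨k, hinj (by rw [map_zsmul, hk])⟩
  have hfg : f g ≠ 0 := by
    obtain ⟨m, hm⟩ := hne
    obtain ⟨k, rfl⟩ := hgen m
    intro h
    rw [map_zsmul, h, smul_zero] at hm
    exact hm rfl
  rcases lt_or_gt_of_ne hfg with h | h
  · refine ⟨-g, fun m => ?_, ?_⟩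
    · obtain ⟨k, rfl⟩ := hgen m
      exact ⟨-k, by simp⟩
    · have : f (-g) = -f g := map_neg f g
      change 0 < f (-g)
      omega
  · exact ⟨g, hgen, h⟩

open scoped Classical in
/-- The class of the curve of a wall, on the chart of one of its two sides. -/
theorem Curve.numClass_eq_smul_rel (hX : X.IsComplete) (Z : X.Curve K) (hZ : Z.ideal = ⊥)
    {σ : Finset ι} {i κ : ι} (h : X.IsWall σ i κ) (horb : Z.orbit = σ.erase i)
    (hchart : Z.chart = σ) : ∃ s : ℝ, 0 < s ∧ Z.numClass = s • X.rel σ κ := by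
  have hloc := fun v => Z.isLocation_location hX v
  -- Each place is located in one of the two cones at the wall. In `σ` it contributes nothing; in
  -- the other cone only the generator `u_κ` has a nontrivial relation.
  have hterm : ∀ v, ∃ t : ℝ, 0 ≤ t ∧
      (X.coord σ i (fun j => ((Z.location v).2 j : ℝ)) < 0 → 0 < t) ∧
      ∑ ρ, X.coord (Z.location v).1 ρ (fun j => ((Z.location v).2 j : ℝ)) • X.rel σ ρ =
        t • X.rel σ κ := by
    intro v
    have hcone := (mem_cone_iff (hloc v).1).1 (hloc v).2.2.2
    rcases h.eq_or_eq (hloc v).1 (horb ▸ (hloc v).2.1) with heq | heq <;> rw [heq] at hcone ⊢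
    · refine ⟨0, le_rfl, fun hneg => absurd (hcone i) hneg.not_ge, ?_⟩
      rw [zero_smul]
      refine Finset.sum_eq_zero fun ρ _ => ?_
      by_cases hρ : ρ ∈ σ
      · rw [rel_eq_zero h.1.1 hρ, smul_zero]
      · rw [coord_eq_zero h.1 hρ, LinearMap.zero_apply, zero_smul]
    · exact ⟨_, hcone κ, h.coord_pos, h.sum_coord_smul_rel _⟩
  choose t ht0 htpos ht using hterm
  refine ⟨∑ v ∈ Z.boundary, (v.deg : ℝ) * t v, ?_, ?_⟩
  · have hg : ∃ g : X.perp Z.orbit, (∀ m, ∃ k : ℤ, m = k • g) ∧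
        0 < (g : Fin n → ℤ) ⬝ᵥ X.u i := by
      rw [horb]
      exact exists_generator_perp h.1 h.2.1
    obtain ⟨g, hgen, hgi⟩ := hg
    -- Strict positivity comes from the pole of `χ^g`. Since `g` is a positive multiple of `coord σ
    -- i`, order `-1` puts the vector of this place on the far side of the wall.
    obtain ⟨v, hdeg, hord⟩ := Z.exists_place hZ hgen (by rintro rfl; simp at hgi)
    have hv : v ∈ Z.boundary := by
      rw [Curve.boundary, Set.Finite.mem_toFinset]
      intro h0
      have : v.ord (Z.char g) = 0 := DFunLike.congr_fun h0 g
      omega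
    refine Finset.sum_pos' (fun v _ => mul_nonneg (Nat.cast_nonneg _) (ht0 v)) ⟨v, hv, ?_⟩
    rw [hdeg, Nat.cast_one, one_mul]
    refine htpos v ?_
    have h1 : pairing (fun j => ((g : Fin n → ℤ) j : ℚ)) =
        (((g : Fin n → ℤ) ⬝ᵥ X.u i : ℤ) : ℝ) • X.coord σ i := by
      refine linearMap_ext h.1 fun ρ hρ => ?_
      have h2 : pairing (fun j => ((g : Fin n → ℤ) j : ℚ)) (X.vec ρ) =
          (((g : Fin n → ℤ) ⬝ᵥ X.u ρ : ℤ) : ℝ) := by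
        simp [pairing_apply, vec, dotProduct]
      rw [h2, LinearMap.smul_apply, coord_vec h.1.1 i hρ]
      split_ifs with h3
      · rw [h3, smul_eq_mul, mul_one]
      · rw [mem_perp.1 g.2 ρ (horb ▸ Finset.mem_erase.2 ⟨h3, hρ⟩)]
        simp
    have h2 := (hloc v).2.2.1 g
    rw [hord] at h2
    have h3 : pairing (fun j => ((g : Fin n → ℤ) j : ℚ)) (fun j => ((Z.location v).2 j : ℝ)) =
        -1 := by
      have : ((-1 : ℤ) : ℝ) = (((g : Fin n → ℤ) ⬝ᵥ (Z.location v).2 : ℤ) : ℝ) := by rw [← h2]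
      rw [Int.cast_neg, Int.cast_one] at this
      rw [this]
      simp [pairing_apply, dotProduct]
    rw [h1, LinearMap.smul_apply, smul_eq_mul] at h3
    have h4 : (0 : ℝ) < ((g : Fin n → ℤ) ⬝ᵥ X.u i : ℤ) := by exact_mod_cast hgi
    by_contra! h5
    have := mul_nonneg h4.le h5
    linarith
  · rw [Z.numClass_eq_sum hX, hchart, Finset.sum_smul]
    refine Finset.sum_congr rfl fun v _ => ?_
    rw [mul_smul, ← ht v, Finset.smul_sum]
    exact Finset.sum_congr rfl fun ρ _ => mul_smul _ _ _

variable (K) in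
/-- Every wall relation is, up to a positive factor, the class of a curve. -/
theorem IsWall.exists_curve (hX : X.IsComplete) {σ : Finset ι} {i κ : ι} (h : X.IsWall σ i κ) :
    ∃ Z : X.Curve K, ∃ s : ℝ, 0 < s ∧ Z.numClass = s • X.rel σ κ := by
  classical
  obtain ⟨g, hgen, hgi⟩ := exists_generator_perp h.1 h.2.1
  obtain ⟨Z, horb, hZ⟩ := SimplicialFan.exists_curve K
    (X.face_mem σ h.1.1 _ (Finset.erase_subset i σ)) hgen (by rintro rfl; simp at hgi)
  refine ⟨Z, ?_⟩
  have hchart := Z.chart_mem hX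
  -- The chosen chart may be on either side of the wall; switching sides only rescales the relation
  -- by a positive factor.
  rcases h.eq_or_eq hchart.1 (horb ▸ hchart.2) with hσ | hσ
  · exact Z.numClass_eq_smul_rel hX hZ (by convert h) (by convert horb) hσ
  · obtain ⟨s, hs, hs'⟩ := Z.numClass_eq_smul_rel hX hZ h.symm
      (by rw [horb, h.erase_insert]) hσ
    obtain ⟨a, ha, ha'⟩ := h.rel_symm
    exact ⟨s * a, mul_pos hs ha, by rw [hs', mul_smul, ← ha']⟩

end SimplicialFan

/-! ### Finitely generated salient cones -/

section Cone

theorem real_smul_mem_span {E : Type*} [AddCommGroup E] [Module ℝ E] {S : Set E} {x : E}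
    (hx : x ∈ Submodule.span ℝ≥0 S) {r : ℝ} (hr : 0 ≤ r) : r • x ∈ Submodule.span ℝ≥0 S :=
  Submodule.smul_mem _ (⟨r, hr⟩ : ℝ≥0) hx

theorem exists_pos_of_mem_span {E : Type*} [AddCommGroup E] [Module ℝ E] {S : Set E} (f : E →ₗ[ℝ] ℝ)
    {x : E} (hx : x ∈ Submodule.span ℝ≥0 S) (hfx : 0 < f x) : ∃ v ∈ S, 0 < f v := by
  by_contra! h
  refine hfx.not_ge ?_
  induction hx using Submodule.span_induction with
  | mem v hv => exact h v hv
  | zero => simp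
  | add a b _ _ ha hb =>
    by_contra! hab
    rw [map_add] at hab
    have ha' : f a ≤ 0 := not_lt.1 fun h' => (ha h').not_gt h'
    have hb' : f b ≤ 0 := not_lt.1 fun h' => (hb h').not_gt h'
    linarith
  | smul a b _ hb =>
    by_contra! hab
    rw [NNReal.smul_def, map_smul, smul_eq_mul] at hab
    have := pos_of_mul_pos_right hab a.2
    exact (hb this).not_gt this

theorem eq_zero_or_pos_of_mem_span {E : Type*} [AddCommGroup E] [Module ℝ E] {S : Set E}
    {f : E →ₗ[ℝ] ℝ} (hf : ∀ v ∈ S, 0 < f v) {x : E} (hx : x ∈ Submodule.span ℝ≥0 S) :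
    x = 0 ∨ 0 < f x := by
  induction hx using Submodule.span_induction with
  | mem v hv => exact Or.inr (hf v hv)
  | zero => exact Or.inl rfl
  | add a b _ _ ha hb =>
    rcases ha with rfl | ha
    · simpa using hb
    · rcases hb with rfl | hb
      · exact Or.inr (by simpa using ha)
      · exact Or.inr (by rw [map_add]; exact add_pos ha hb)
  | smul a b _ hb =>
    rcases hb with rfl | hb
    · simp
    · rcases eq_or_ne a 0 with rfl | ha
      · simp
      · refine Or.inr ?_
        rw [NNReal.smul_def, map_smul, smul_eq_mul]
        exact mul_pos (NNReal.coe_pos.2 (pos_iff_ne_zero.2 ha)) hb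

/-- A finitely generated cone is closed, if some linear form is positive on its generators. -/
theorem isClosed_span_of_pos {ι : Type*} [Fintype ι] (V : Finset (ι → ℝ)) {f : (ι → ℝ) →ₗ[ℝ] ℝ}
    (hf : ∀ v ∈ V, 0 < f v) : IsClosed (Submodule.span ℝ≥0 (V : Set (ι → ℝ)) : Set (ι → ℝ)) := by
  refine isClosed_of_closure_subset fun x hx => ?_
  -- Near `x` the form `f` stays below `B`, which bounds the coefficient of each `v` by `B / f v`.
  -- There the cone is contained in a compact image of a box.
  set B := f x + 1 with hB
  let A : Set (V → ℝ) := Set.univ.pi fun v => Set.Icc 0 (B / f v)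
  have hA : IsCompact A := isCompact_univ_pi fun _ => isCompact_Icc
  let g : (V → ℝ) → ι → ℝ := fun a => ∑ v, a v • (v : ι → ℝ)
  have hg : Continuous g := continuous_finsetSum _ fun v _ =>
    (continuous_apply v).smul continuous_const
  have hopen : IsOpen {y : ι → ℝ | f y < B} :=
    isOpen_lt f.continuous_of_finiteDimensional continuous_const
  have hsub : {y : ι → ℝ | f y < B} ∩ Submodule.span ℝ≥0 (V : Set (ι → ℝ)) ⊆ g '' A := by
    rintro y ⟨hyB, hy⟩
    obtain ⟨a, -, rfl⟩ := Submodule.mem_span_finset.1 hy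
    refine ⟨fun v => a v, fun v _ => ⟨(a v).2, ?_⟩, ?_⟩
    · rw [le_div_iff₀ (hf v v.2)]
      refine le_trans ?_ (le_of_lt hyB)
      rw [map_sum]
      refine (Finset.single_le_sum (f := fun w => f (a w • w)) (fun w hw => ?_) v.2).trans_eq' ?_
      · rw [NNReal.smul_def, map_smul]
        exact mul_nonneg (a w).2 (hf w hw).le
      · dsimp only
        rw [NNReal.smul_def, map_smul, smul_eq_mul]
    · exact Finset.sum_coe_sort V fun v => (a v : ℝ) • v
  have hx' : x ∈ g '' A := by
    rw [← (hA.image hg).isClosed.closure_eq]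
    refine closure_mono hsub (hopen.inter_closure ⟨?_, hx⟩)
    change f x < B
    rw [hB]
    linarith
  obtain ⟨a, ha, rfl⟩ := hx'
  exact Submodule.sum_mem _ fun v _ =>
    real_smul_mem_span (Submodule.subset_span v.2) (ha v trivial).1

/-- The members of a minimal generating set of a salient cone generate extremal rays. -/
theorem extremal_of_notMem_span {E : Type*} [AddCommGroup E] [Module ℝ E] {V : Set E}
    {f : E →ₗ[ℝ] ℝ} (hf : ∀ v ∈ V, 0 < f v) {c : E} (hc : c ∈ V)
    (hmin : c ∉ Submodule.span ℝ≥0 (V \ {c})) {x y : E} (hx : x ∈ Submodule.span ℝ≥0 V)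
    (hy : y ∈ Submodule.span ℝ≥0 V) {t : ℝ≥0} (hxy : x + y = t • c) :
    (∃ s : ℝ≥0, x = s • c) ∧ ∃ s : ℝ≥0, y = s • c := by
  have hV : V = insert c (V \ {c}) := by
    rw [Set.insert_sdiff_singleton, Set.insert_eq_of_mem hc]
  rw [hV, Submodule.mem_span_insert] at hx hy
  obtain ⟨a, x', hx', rfl⟩ := hx
  obtain ⟨b, y', hy', rfl⟩ := hy
  have hsum : x' + y' = ((t : ℝ) - a - b) • c := by
    simp only [NNReal.smul_def] at hxy
    rw [sub_smul, sub_smul, ← hxy]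
    abel
  have hf' : ∀ v ∈ V \ {c}, 0 < f v := fun v hv => hf v hv.1
  -- A positive coefficient would put `c` in the span of the other generators. With a nonpositive
  -- one, positivity of `f` forces `x'` and `y'` to vanish.
  have hle : (t : ℝ) - a - b ≤ 0 := by
    by_contra! h
    refine hmin ?_
    have h1 := real_smul_mem_span (Submodule.add_mem _ hx' hy') (inv_pos.2 h).le
    rwa [hsum, inv_smul_smul₀ h.ne'] at h1
  have hfle : f x' + f y' ≤ 0 := by
    rw [← map_add, hsum, map_smul, smul_eq_mul]
    exact mul_nonpos_of_nonpos_of_nonneg hle (hf c hc).le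
  have h0 : x' = 0 ∧ y' = 0 := by
    rcases eq_zero_or_pos_of_mem_span hf' hx' with rfl | h1
    · rcases eq_zero_or_pos_of_mem_span hf' hy' with rfl | h2
      · exact ⟨rfl, rfl⟩
      · rw [map_zero] at hfle
        linarith
    · rcases eq_zero_or_pos_of_mem_span hf' hy' with rfl | h2
      · rw [map_zero] at hfle
        linarith
      · linarith
  rw [h0.1, h0.2]
  exact ⟨⟨a, add_zero _⟩, ⟨b, add_zero _⟩⟩

/-- A generating subset of least cardinality has no redundant member, as `extremal_of_notMem_span`
requires. -/
theorem exists_minimal_generators {E : Type*} [AddCommGroup E] [Module ℝ E] (V : Finset E) :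
    ∃ W ⊆ V, Submodule.span ℝ≥0 (W : Set E) = Submodule.span ℝ≥0 (V : Set E) ∧
      ∀ c ∈ W, c ∉ Submodule.span ℝ≥0 ((W : Set E) \ {c}) := by
  classical
  obtain ⟨W, hW, hmin⟩ := Finset.exists_min_image
    (V.powerset.filter fun W : Finset E =>
      Submodule.span ℝ≥0 (W : Set E) = Submodule.span ℝ≥0 (V : Set E))
    Finset.card ⟨V, by simp⟩
  rw [Finset.mem_filter, Finset.mem_powerset] at hW
  refine ⟨W, hW.1, hW.2, fun c hc h => ?_⟩
  have h1 : Submodule.span ℝ≥0 ((W.erase c : Finset E) : Set E) =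
      Submodule.span ℝ≥0 (V : Set E) := by
    rw [← hW.2, Finset.coe_erase]
    refine le_antisymm (Submodule.span_mono Set.sdiff_subset) (Submodule.span_le.2 fun v hv => ?_)
    by_cases hvc : v = c
    · rwa [hvc]
    · exact Submodule.subset_span ⟨hv, hvc⟩
  have h2 := hmin (W.erase c)
    (Finset.mem_filter.2 ⟨Finset.mem_powerset.2 ((Finset.erase_subset _ _).trans hW.1), h1⟩)
  exact (Finset.card_erase_lt_of_mem hc).not_ge h2

end Cone

/-! ### The toric cone theorem -/

namespace SimplicialFan

variable {n : ℕ} {ι : Type*} [Fintype ι] {X : SimplicialFan n ι} {K : Type*} [Field K]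

/-- The linear form `c ↦ c · D` on numerical classes. -/
def degreeForm (D : ι → ℤ) : (ι → ℝ) →ₗ[ℝ] ℝ := dotProductBilin ℝ ℝ fun ρ => (D ρ : ℝ)

theorem degreeForm_apply (D : ι → ℤ) (c : ι → ℝ) : degreeForm D c = ∑ ρ, (D ρ : ℝ) * c ρ := rfl

/-- The linear form `c ↦ ∑_{ρ ∈ I} c · D_ρ - c · D` on numerical classes. -/
def excessForm (D : ι → ℤ) (I : Finset ι) : (ι → ℝ) →ₗ[ℝ] ℝ :=
  ∑ ρ ∈ I, LinearMap.proj ρ - degreeForm D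

theorem excessForm_apply (D : ι → ℤ) (I : Finset ι) (c : ι → ℝ) :
    excessForm D I c = ∑ ρ ∈ I, c ρ - degreeForm D c := by
  simp [excessForm, LinearMap.sum_apply]

/-- By linearity of `inter` in the divisor, both sides depend only on the numerical class, so the
inequality becomes the sign of a linear form. -/
theorem OneCycle.inter_lt_iff (hX : X.IsComplete) (C : X.OneCycle K) (D : ι → ℤ) (I : Finset ι) :
    C.inter D < ∑ ρ ∈ I, C.inter (rayDivisor ρ) ↔ 0 < excessForm D I C.numClass := by
  have h1 : ((C.inter D : ℚ) : ℝ) = degreeForm D C.numClass := by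
    rw [C.inter_eq_sum hX, degreeForm_apply]
    simp [OneCycle.numClass]
  rw [excessForm_apply, sub_pos, ← h1, ← Rat.cast_lt (K := ℝ), Rat.cast_sum]
  rfl

theorem OneCycle.numClass_mem_span_of_isEffective {S : Set (ι → ℝ)}
    (hS : ∀ Z : X.Curve K, Z.numClass ∈ Submodule.span ℝ≥0 S) {C : X.OneCycle K}
    (hC : C.IsEffective) : C.numClass ∈ Submodule.span ℝ≥0 S := by
  rw [C.numClass_eq_sum]
  exact Submodule.sum_mem _ fun Z _ =>
    Submodule.smul_mem _ (⟨(C Z : ℝ), by exact_mod_cast hC Z⟩ : ℝ≥0) (hS Z)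

theorem OneCycle.isEffective_single (Z : X.Curve K) :
    IsEffective (Finsupp.single Z 1 : X.OneCycle K) := by
  classical
  intro Z'
  rw [Finsupp.single_apply]
  split_ifs <;> norm_num

variable (K) in
/-- The toric cone theorem: the Mori cone is generated by the classes of finitely many curves, on
which every ample divisor is positive. -/
theorem exists_moriCone_eq_span (hX : X.IsComplete) {D : ι → ℤ} (hD : X.IsAmple D) :
    ∃ V : Finset (ι → ℝ), (∀ c ∈ V, ∃ Z : X.Curve K, Z.numClass = c) ∧
      (∀ c ∈ V, 0 < degreeForm D c) ∧
      (∀ C : X.OneCycle K, C.IsEffective → C.numClass ∈ Submodule.span ℝ≥0 (V : Set (ι → ℝ))) ∧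
      X.moriCone K = Submodule.span ℝ≥0 (V : Set (ι → ℝ)) := by
  classical
  let W := {p : Finset ι × ι × ι // X.IsWall p.1 p.2.1 p.2.2}
  have hW : ∀ p : W, ∃ Z : X.Curve K, ∃ s : ℝ, 0 < s ∧ Z.numClass = s • X.rel p.1.1 p.1.2.2 :=
    fun p => p.2.exists_curve K hX
  choose Z s hs hZ using hW
  let V : Finset (ι → ℝ) := Finset.univ.image fun p => (Z p).numClass
  have hmemV : ∀ p, (Z p).numClass ∈ V := fun p => Finset.mem_image_of_mem _ (Finset.mem_univ p)
  have hVZ : ∀ c ∈ V, ∃ p, (Z p).numClass = c := fun c hc => by simpa [V] using hc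
  have hspan : Submodule.span ℝ≥0 {r | ∃ σ i κ, X.IsWall σ i κ ∧ r = X.rel σ κ} ≤
      Submodule.span ℝ≥0 (V : Set (ι → ℝ)) := by
    refine Submodule.span_le.2 ?_
    rintro _ ⟨σ, i, κ, hw, rfl⟩
    let p : W := ⟨(σ, i, κ), hw⟩
    have h1 := real_smul_mem_span (Submodule.subset_span (hmemV p)) (inv_pos.2 (hs p)).le
    rwa [hZ, inv_smul_smul₀ (hs p).ne'] at h1
  have heff : ∀ C : X.OneCycle K, C.IsEffective →
      C.numClass ∈ Submodule.span ℝ≥0 (V : Set (ι → ℝ)) := fun C hC =>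
    OneCycle.numClass_mem_span_of_isEffective (fun Z => hspan (Z.numClass_mem_span hX hD)) hC
  have hpos : ∀ c ∈ V, 0 < degreeForm D c := by
    intro c hc
    obtain ⟨p, rfl⟩ := hVZ c hc
    rw [hZ, map_smul, smul_eq_mul]
    exact mul_pos (hs p) (hD.sum_mul_rel_pos p.2.1 p.2.2.2.1)
  refine ⟨V, fun c hc => (hVZ c hc).imp' Z fun _ h => h, hpos, heff, ?_⟩
  have hle : Submodule.span ℝ≥0 {c : ι → ℝ | ∃ C : X.OneCycle K, C.IsEffective ∧ c = C.numClass} =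
      Submodule.span ℝ≥0 (V : Set (ι → ℝ)) := by
    refine le_antisymm (Submodule.span_le.2 ?_) (Submodule.span_mono fun c hc => ?_)
    · rintro _ ⟨C, hC, rfl⟩
      exact heff C hC
    · obtain ⟨p, rfl⟩ := hVZ c hc
      exact ⟨_, OneCycle.isEffective_single (Z p), (OneCycle.numClass_single (Z p)).symm⟩
  rw [moriCone, hle, (isClosed_span_of_pos V hpos).closure_eq]

end SimplicialFan

end Toric

end

/-! ### The equivalence -/

theorem proposition4p13 {K : Type*} [Field K] {n : ℕ} {ι : Type*} [Fintype ι]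
    (X : Toric.SimplicialFan n ι) (hX : X.IsProjective) (D : ι → ℤ) (hD : X.IsAmple D) :
    (∃ (C : X.OneCycle K) (I : Finset ι), C.IsEffective ∧
        C.inter D < ∑ ρ ∈ I, C.inter (Toric.SimplicialFan.rayDivisor ρ)) ↔
      (∃ C : X.OneCycle K, X.IsExtremalClass K C.numClass ∧
        C.inter D < ∑ ρ ∈ C.Jplus, C.inter (Toric.SimplicialFan.rayDivisor ρ)) := by
  open Toric SimplicialFan in
  constructor
  · rintro ⟨C, I, hC, hlt⟩
    rw [C.inter_lt_iff hX.1] at hlt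
    obtain ⟨V, hVZ, hpos, heff, hmori⟩ := exists_moriCone_eq_span K hX.1 hD
    obtain ⟨W, hWV, hWspan, hWmin⟩ := exists_minimal_generators V
    have hposW : ∀ c ∈ (W : Set (ι → ℝ)), 0 < degreeForm D c := fun c hc => hpos c (hWV hc)
    have hmem := heff C hC
    rw [← hWspan] at hmori hmem
    -- A form positive on a nonnegative combination is positive on one of the generators, here a
    -- minimal one.
    obtain ⟨c, hc, hlt⟩ := exists_pos_of_mem_span (excessForm D I) hmem hlt
    obtain ⟨Z, rfl⟩ := hVZ c (hWV hc)
    refine ⟨Finsupp.single Z 1, ?_, ?_⟩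
    · rw [OneCycle.numClass_single, IsExtremalClass, hmori]
      refine ⟨Submodule.subset_span hc, fun h0 => ?_, fun x hx y hy ⟨t, ht⟩ =>
        extremal_of_notMem_span hposW hc (hWmin _ hc) hx hy ht⟩
      have := hposW _ hc
      rw [h0, map_zero] at this
      exact this.false
    · rw [← OneCycle.numClass_single, ← OneCycle.inter_lt_iff hX.1] at hlt
      -- Dropping the nonpositive terms of `I` and adding the missing positive ones gives the sum
      -- over `J_C^+`.
      refine hlt.trans_le ?_
      rw [OneCycle.Jplus, Finset.sum_filter]
      refine (Finset.sum_le_sum (g := fun ρ => if 0 < OneCycle.inter (Finsupp.single Z 1)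
        (rayDivisor ρ) then OneCycle.inter (Finsupp.single Z 1) (rayDivisor ρ) else 0)
        fun ρ _ => ?_).trans (Finset.sum_le_univ_sum_of_nonneg fun ρ => ?_)
      · split_ifs with h
        · exact le_rfl
        · exact not_lt.1 h
      · split_ifs with h
        · exact h.le
        · exact le_rfl
  · rintro ⟨C, hext, hlt⟩
    rw [C.inter_lt_iff hX.1] at hlt
    have hopen : IsOpen {c : ι → ℝ | 0 < excessForm D C.Jplus c} :=
      isOpen_lt continuous_const (excessForm D C.Jplus).continuous_of_finiteDimensional
    -- Of extremality only membership in the closure is needed; `C` itself may fail to be effective.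
    obtain ⟨x, hx, hxmem⟩ := mem_closure_iff.1 hext.1 _ hopen hlt
    obtain ⟨_, ⟨C', hC', rfl⟩, hlt'⟩ := exists_pos_of_mem_span _ hxmem hx
    exact ⟨C', C.Jplus, hC', (C'.inter_lt_iff hX.1 D _).2 hlt'⟩
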